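/- **Notation.** Let $\mathbb H$ be the complex upper half-plane and $q=e^{2\pi i\tau}$ for $\tau\in\mathbb H$. For integers $t,k,N\ge 1$ and a polynomial $Q\in\mathbb C[x]$, with $\Phi_N$ the $N$-th cyclotomic polynomial, put $$\mathcal U_{t,k;N}(Q;q)=\sum_{1\le n_1<n_2<\cdots<n_t}\ \prod_{j=1}^{t}\frac{Q(q^{n_j})}{\Phi_N(q^{n_j})^k},\qquad \mathcal U^{\star}_{t,k;N}(Q;q)=\sum_{1\le n_1\le n_2\le\cdots\le n_t}\ \prod_{j=1}^{t}\frac{Q(q^{n_j})}{\Phi_N(q^{n_j})^k},$$ $$\mathcal U_{k;N}(Q;q)=\mathcal U_{1,k;N}(Q;q)=\mathcal U^{\star}_{1,k;N}(Q;q)=\sum_{n\ge 1}\frac{Q(q^n)}{\Phi_N(q^n)^k}.$$ A quasimodular form of weight $w$ and character $\chi$ (a Dirichlet character modulo $M$) on $\Gamma_0(M)$ is a holomorphic function $f:\mathbb H\to\mathbb C$ for which there are an integer $s\ge 0$ and holomorphic functions $f_0,\dots,f_s:\mathbb H\to\mathbb C$ with $$f\!\left(\frac{a\tau+b}{c\tau+d}\right)=\chi(d)(c\tau+d)^w\sum_{i=0}^{s}f_i(\tau)\left(\frac{c}{c\tau+d}\right)^i\qquad\text{for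 all }\begin{pmatrix}a&b\\c&d\end{pmatrix}\in\Gamma_0(M),\ \tau\in\mathbb H,$$ and which is holomorphic at all cusps, i.e. for every $\gamma=\begin{pmatrix}a&b\\c&d\end{pmatrix}\in\mathrm{SL}_2(\mathbb Z)$ the function $(c\tau+d)^{-w}f(\gamma\tau)$ is bounded on $\{\operatorname{Im}\tau\ge A\}$ for some $A>0$. A mixed-weight quasimodular form of weight at most $k$ and level at most $N$ is a finite $\mathbb C$-linear combination of quasimodular forms of integer weights $0\le w\le k$ on groups $\Gamma_0(M)$ with $M\mid N$, with arbitrary characters modulo $M$. **Theorem.** Let $t,k,N\ge 1$ be integers and let $Q\in\mathbb C[x]$ be a polynomial of degree less than $\phi(N)k$, where $\phi$ is Euler's totient function, with $Q(0)=0$ and, for all $x\neq 0$, $$Q(x)=\begin{cases}(-x)^kQ(1/x)&\text{if }N=1,\\ x^{\phi(N)k}Q(1/x)&\text{if }N\ge 2.\end{cases}$$ Then the series $\mathcal U_{k;N}(Q;q)$, $\mathcal U_{t,k;N}(Q;q)$ and $\mathcal U^{\star}_{t,k;N}(Q;q)$ converge absolutely for $|q|<1$, and the following hold. (1) $\mathcal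 U_{k;N}(Q;q)$, as a function of $\tau$, is a mixed-weight quasimodular form of weight at most $k$ and level at most $N$. (2) For $|q|<1$, $$\mathcal U_{t,k;N}(Q;q)=\sum_{\lambda\vdash t}\prod_{s=1}^{t}\frac{1}{m_{\lambda,s}!}\left(\frac{(-1)^{s-1}\,\mathcal U_{sk;N}(Q^s;q)}{s}\right)^{m_{\lambda,s}},\qquad \mathcal U^{\star}_{t,k;N}(Q;q)=\sum_{\lambda\vdash t}\prod_{s=1}^{t}\frac{1}{m_{\lambda,s}!}\left(\frac{\mathcal U_{sk;N}(Q^s;q)}{s}\right)^{m_{\lambda,s}},$$ where $\lambda$ runs over the partitions of $t$ and $m_{\lambda,s}$ is the multiplicity of $s$ in $\lambda$. These are isobaric polynomials of weight $t$ with rational coefficients in the variables $\mathcal U_{sk;N}(Q^s;q)$, $1\le s\le t$: each term is a rational multiple of a monomial $\prod_{s=1}^t\mathcal U_{sk;N}(Q^s;q)^{r_s}$ with $r_1+2r_2+\cdots+tr_t=t$. Moreover, $\mathcal U_{t,k;N}(Q;q)$ and $\mathcal U^{\star}_{t,k;N}(Q;q)$, as functions of $\tau$, are mixed-weight quasimodular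 forms of weight at most $tk$ and level at most $N$. -/

import Mathlib

open scoped UpperHalfPlane MatrixGroups Manifold ModularForm Polynomial

noncomputable section

namespace GenMacMahon

/-- A quasimodular form of weight `k` and character `χ` on `Γ₀(N)`: a holomorphic function on the
upper half-plane with the quasimodular transformation law, holomorphic at all cusps. Every cusp is
`γ • ∞` for some `γ ∈ SL(2, ℤ)`, and holomorphy there means that `f ∣[k] γ` stays bounded as
`Im τ → ∞` (uniformly in `Re τ`). -/
structure IsQuasimodular (k : ℤ) {N : ℕ} (χ : DirichletCharacter ℂ N) (f : ℍ → ℂ) : Prop where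
  holo : MDifferentiable 𝓘(ℂ) 𝓘(ℂ) f
  transform : ∃ (s : ℕ) (F : ℕ → ℍ → ℂ),
    (∀ i ≤ s, MDifferentiable 𝓘(ℂ) 𝓘(ℂ) (F i)) ∧
    ∀ γ ∈ CongruenceSubgroup.Gamma0 N, ∀ τ : ℍ,
      f (γ • τ) = χ ((γ 1 1 : ℤ) : ZMod N) * ((γ 1 0 : ℂ) * τ + (γ 1 1 : ℂ)) ^ k *
        ∑ i ∈ Finset.range (s + 1),
          F i τ * ((γ 1 0 : ℂ) / ((γ 1 0 : ℂ) * τ + (γ 1 1 : ℂ))) ^ i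
  bdd_at_cusps : ∀ γ : SL(2, ℤ), UpperHalfPlane.IsBoundedAtImInfty (f ∣[k] γ)

/-- A mixed-weight quasimodular form of weight at most `k` and level at most `N`: a finite linear
combination of quasimodular forms of weights `w ≤ k` on groups `Γ₀(M)`, with `M` a divisor of `N`,
with arbitrary characters modulo `M`. -/
def IsMixedQuasimodular (k N : ℕ) (f : ℍ → ℂ) : Prop :=
  f ∈ Submodule.span ℂ {g : ℍ → ℂ | ∃ w : ℕ, w ≤ k ∧ ∃ M : ℕ, M ∣ N ∧
    ∃ χ : DirichletCharacter ℂ M, IsQuasimodular (w : ℤ) χ g}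

/-- `Q(x) / Φ_N(x) ^ k`. -/
def ratio (k N : ℕ) (Q : ℂ[X]) (x : ℂ) : ℂ :=
  Q.eval x / (Polynomial.cyclotomic N ℂ).eval x ^ k

/-- The term of the multiple series at the tuple `(n₁, …, n_t)`. -/
def term (t k N : ℕ) (Q : ℂ[X]) (q : ℂ) (n : Fin t → ℕ+) : ℂ :=
  ∏ j, ratio k N Q (q ^ (n j : ℕ))

/-- `U_{k;N}(Q; q) = ∑_{n ≥ 1} Q(q ^ n) / Φ_N(q ^ n) ^ k`. -/
def U₁ (k N : ℕ) (Q : ℂ[X]) (q : ℂ) : ℂ :=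
  ∑' n : ℕ+, ratio k N Q (q ^ (n : ℕ))

/-- `U_{t,k;N}(Q; q)`: the sum over `1 ≤ n₁ < n₂ < ⋯ < n_t`. -/
def U (t k N : ℕ) (Q : ℂ[X]) (q : ℂ) : ℂ :=
  ∑' n : {n : Fin t → ℕ+ // StrictMono n}, term t k N Q q n.1

/-- `U⋆_{t,k;N}(Q; q)`: the sum over `1 ≤ n₁ ≤ n₂ ≤ ⋯ ≤ n_t`. -/
def UStar (t k N : ℕ) (Q : ℂ[X]) (q : ℂ) : ℂ :=
  ∑' n : {n : Fin t → ℕ+ // Monotone n}, term t k N Q q n.1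

/-- The parameter `q = e ^ (2πiτ)`. -/
def qOf (τ : ℍ) : ℂ := Complex.exp (2 * Real.pi * Complex.I * τ)

/-- The coefficient of `X ^ t` in `exp (∑_{s ≥ 1} ε ^ (s - 1) / s * x_s * X ^ s)`, as given by the
exponential formula: `∑_{λ ⊢ t} ∏_{s = 1}^{t} (1 / m_s!) * (ε ^ (s - 1) * x_s / s) ^ m_s`, with `m_s`
the multiplicity of `s` in `λ`. The variable of index `s : Fin t` stands for `x_{s + 1}`. -/
def expPoly (ε : ℚ) (t : ℕ) : MvPolynomial (Fin t) ℚ :=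
  ∑ p : Nat.Partition t, ∏ s : Fin t,
    MvPolynomial.C (1 / ((p.parts.count (s.val + 1)).factorial : ℚ)) *
      (MvPolynomial.C (ε ^ s.val / ((s.val : ℚ) + 1)) * MvPolynomial.X s) ^
        (p.parts.count (s.val + 1))

/-- A polynomial in `x_1, …, x_t` that is isobaric of weight `n`: each of its monomials
`x_1 ^ s_1 ⋯ x_t ^ s_t` satisfies `s_1 + 2 s_2 + ⋯ + t s_t = n`. -/
def IsIsobaric {t : ℕ} (P : MvPolynomial (Fin t) ℚ) (n : ℕ) : Prop :=
  P.IsWeightedHomogeneous (fun s : Fin t => s.val + 1) n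

end GenMacMahon

end

/-! Write `ratio` for `Q/Φ_N^k`. The reciprocity of `Q` and of `Φ_N` makes `ratio` invariant under
`x ↦ 1/x`. Its poles are the primitive `N`-th roots of unity, of order at most `k`. Partial
fractions, written in the basis of polylogarithms `Li_{-j}` with `j < k` and averaged with their
images under `x ↦ 1/x`, leave only combinations of `Li_{-j}(r⁻¹x) + (-1)^(j+1) Li_{-j}(rx)`
(`IsReciprocalNumerator.exists_ratio_eq`). The constant term vanishes because `Q(0) = 0`.

Summing over `x = q^n` gives symmetrised Lambert series. Up to a constant these are the values, at
torsion points `z = a/N`, of the `j`-th `z`-derivative of the regularised sum `Z(z, τ) = (i/2) ∑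
cot(π(z + nτ))`, which is `zetaDeriv`. Liouville's theorem gives its modular law `(cτ+d)⁻¹
Z(z/(cτ+d), γτ) = Z(z, τ) - cz/(cτ+d)` (`zetaDeriv_zero_smul`), and differentiating in `z` gives the
law in weight `j + 1` (`zetaDeriv_smul`), with an anomaly constant in `z` when `j = 1`. At `z = a/N`
the group `Γ₀(N)` permutes the residues by `a ↦ ad`, and the behaviour under all of `SL(2, ℤ)` gives
boundedness at the cusps. For `N = 1`, where the torsion point is the pole `z = 0`, the regular part
there plays the same role. Character sums over `a` are quasimodular with character, and
orthogonality recovers each member of the family. This proves (1).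

For (2), the multiple sums are elementary and complete homogeneous symmetric functions of the
sequence `ratio(q^i)`, and `U_{sk;N}(Q^s)` is its `s`-th power sum. The symmetric functions and the
partition sum satisfy the same Newton recursion (`chainTsum_newton`, `expCoeff_newton`), hence
agree. Since `Q^s` satisfies the hypotheses with `sk` in place of `k`, part (1) applies to every
variable; mixed quasimodular forms multiply with weights adding, and each monomial has weight at
most `tk`. -/

noncomputable section

namespace GenMacMahon

open Filter Topology

/-! ### Polylogarithms of nonpositive order and derivatives of the cotangent -/

/-- The polynomials with `R 0 = X - 1/2` and `x d/dx (R j)(1/(1-x)) = (R (j+1))(1/(1-x))`. -/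
def polylogPoly : ℕ → ℂ[X]
  | 0 => Polynomial.X - Polynomial.C (1 / 2)
  | j + 1 => Polynomial.derivative (polylogPoly j) * (Polynomial.X ^ 2 - Polynomial.X)

/-- The polylogarithm `Li_{-j}(x)`, a rational function of `x` vanishing at `0`. -/
def polylog (j : ℕ) (x : ℂ) : ℂ :=
  (polylogPoly j).eval (1 / (1 - x)) - (polylogPoly j).eval 1

/-- The exponential `w ↦ exp (2πiw)`. -/
def qexp (w : ℂ) : ℂ := Complex.exp (2 * Real.pi * Complex.I * w)

/-- The `j`-th derivative `(2πi)⁻ʲ d^j/dw^j` of `(i/2) cot (πw)`. -/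
def cotDeriv (j : ℕ) (w : ℂ) : ℂ := (polylogPoly j).eval (1 / (1 - qexp w))

lemma qexp_add (a b : ℂ) : qexp (a + b) = qexp a * qexp b := by
  simp [qexp, mul_add, Complex.exp_add]

lemma qexp_neg (a : ℂ) : qexp (-a) = (qexp a)⁻¹ := by simp [qexp, Complex.exp_neg]

@[simp] lemma qexp_ne_zero (a : ℂ) : qexp a ≠ 0 := Complex.exp_ne_zero _

@[simp] lemma qexp_zero : qexp 0 = 1 := by simp [qexp]

@[simp] lemma qexp_one : qexp 1 = 1 := by simp [qexp, Complex.exp_two_pi_mul_I]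

lemma qexp_eq_one_iff (a : ℂ) : qexp a = 1 ↔ ∃ n : ℤ, a = n := by
  rw [qexp, Complex.exp_eq_one_iff]
  refine exists_congr fun n => ?_
  rw [mul_comm]
  exact ⟨fun h => mul_right_cancel₀ Complex.two_pi_I_ne_zero h, fun h => by rw [h]⟩

@[simp] lemma qexp_intCast (n : ℤ) : qexp n = 1 := (qexp_eq_one_iff _).2 ⟨n, rfl⟩

lemma qexp_nat_mul (n : ℕ) (a : ℂ) : qexp (n * a) = qexp a ^ n := by
  rw [qexp, qexp, ← Complex.exp_nat_mul]; ring_nf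

lemma norm_qexp (a : ℂ) : ‖qexp a‖ = Real.exp (-2 * Real.pi * a.im) := by
  rw [qexp, Complex.norm_exp]; simp

lemma norm_qexp_lt_one {a : ℂ} (h : 0 < a.im) : ‖qexp a‖ < 1 := by
  rw [norm_qexp, Real.exp_lt_one_iff]
  have := mul_pos Real.pi_pos h
  linarith

lemma hasDerivAt_qexp (w : ℂ) :
    HasDerivAt qexp (2 * Real.pi * Complex.I * qexp w) w := by
  have := ((hasDerivAt_id w).const_mul (2 * Real.pi * Complex.I)).cexp
  convert! this using 1
  simp [qexp]
  ring

lemma differentiable_qexp : Differentiable ℂ qexp := fun w => (hasDerivAt_qexp w).differentiableAt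

/-- If `u = 1/(1-x)` then `1 - u = 1/(1 - 1/x)`, so this is the parity of the cotangent and its
derivatives. In the induction `X^2 - X` is invariant under `X ↦ 1 - X`, and each derivative
contributes a sign. -/
lemma polylogPoly_eval_one_sub (j : ℕ) (u : ℂ) :
    (polylogPoly j).eval (1 - u) = (-1) ^ (j + 1) * (polylogPoly j).eval u := by
  have key : ∀ j, (polylogPoly j).comp (1 - Polynomial.X)
      = Polynomial.C ((-1) ^ (j + 1)) * polylogPoly j := by
    intro j
    induction j with
    | zero =>
      simp only [polylogPoly]
      apply Polynomial.funext
      intro x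
      simp
      ring
    | succ j ih =>
      have h := congrArg Polynomial.derivative ih
      rw [Polynomial.derivative_comp, Polynomial.derivative_C_mul] at h
      simp only [polylogPoly, Polynomial.mul_comp]
      apply Polynomial.funext
      intro x
      have h2 := congrArg (Polynomial.eval x) h
      simp at h2 ⊢
      rw [pow_succ (-1 : ℂ) (j + 1)]
      linear_combination (-(x ^ 2 - x)) * h2
  have := congrArg (Polynomial.eval u) (key j)
  simpa [Polynomial.eval_comp] using this

lemma polylogPoly_eval_one (j : ℕ) :
    (polylogPoly j).eval 1 = if j = 0 then 1 / 2 else 0 := by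
  cases j <;> simp [polylogPoly]; norm_num

/-- The constants by which `polylog` differs from `cotDeriv` cancel after symmetrisation in `x ↦
1/x`. With the opposite sign, in the next lemma, they leave the jump of the cotangent sum under `z ↦
z + τ`. -/
lemma polylogPoly_eval_one_mul (j : ℕ) :
    (polylogPoly j).eval 1 * (1 + (-1) ^ (j + 1)) = 0 := by
  rw [polylogPoly_eval_one]
  split_ifs with h <;> simp [h]

lemma polylogPoly_eval_one_mul' (j : ℕ) :
    (polylogPoly j).eval 1 * (1 + (-1) ^ j) = if j = 0 then 1 else 0 := by
  rw [polylogPoly_eval_one]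
  split_ifs with h <;> simp [h]
  norm_num

lemma cotDeriv_eq (j : ℕ) (w : ℂ) :
    cotDeriv j w = polylog j (qexp w) + (polylogPoly j).eval 1 := by
  simp [cotDeriv, polylog]

lemma cotDeriv_add_one (j : ℕ) (w : ℂ) : cotDeriv j (w + 1) = cotDeriv j w := by
  simp [cotDeriv, qexp_add]

lemma cotDeriv_neg (j : ℕ) {w : ℂ} (hw : qexp w ≠ 1) :
    cotDeriv j (-w) = (-1) ^ (j + 1) * cotDeriv j w := by
  rw [cotDeriv, cotDeriv, ← polylogPoly_eval_one_sub, qexp_neg]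
  congr 1
  have h1 : 1 - qexp w ≠ 0 := sub_ne_zero.2 hw.symm
  have h2 : qexp w - 1 ≠ 0 := sub_ne_zero.2 hw
  have h3 := qexp_ne_zero w
  have h4 : 1 - (qexp w)⁻¹ ≠ 0 := by
    intro h
    apply h2
    field_simp at h
    simpa using h
  field_simp
  ring

/-- The identity `Li_{-j}(1/x) = ± Li_{-j}(x)`, up to constants. -/
lemma polylog_inv (j : ℕ) {x : ℂ} (hx : x ≠ 1) (hx0 : x ≠ 0) :
    polylog j x⁻¹ + (polylogPoly j).eval 1
      = (-1) ^ (j + 1) * (polylog j x + (polylogPoly j).eval 1) := by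
  simp only [polylog, sub_add_cancel]
  rw [← polylogPoly_eval_one_sub]
  congr 1
  have h1 : 1 - x ≠ 0 := sub_ne_zero.2 hx.symm
  have h2 : x - 1 ≠ 0 := sub_ne_zero.2 hx
  have h4 : 1 - x⁻¹ ≠ 0 := by
    intro h
    apply h2
    field_simp at h
    simpa using h
  field_simp
  ring

/-- With `u = 1/(1-f)` one has `u' = f'·(u^2 - u)` when `f'` denotes the logarithmic derivative of
`f`, which is exactly the recursion for `polylogPoly`. The logarithmic form covers both `qexp` and
its multiples by powers of `q`. -/
lemma hasDerivAt_polylog_comp (j : ℕ) {f : ℂ → ℂ} {f' w : ℂ} (hf : HasDerivAt f (f' * f w) w)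
    (hw : f w ≠ 1) :
    HasDerivAt (fun w => (polylogPoly j).eval (1 / (1 - f w)))
      (f' * (polylogPoly (j + 1)).eval (1 / (1 - f w))) w := by
  have h1 : 1 - f w ≠ 0 := sub_ne_zero.2 hw.symm
  have h2 : HasDerivAt (fun w => 1 / (1 - f w)) (f' * f w / (1 - f w) ^ 2) w := by
    have := (hf.const_sub 1).inv h1
    simpa using! this
  have h3 := ((polylogPoly j).hasDerivAt (1 / (1 - f w))).comp w h2
  convert! h3 using 1
  simp only [polylogPoly, Polynomial.eval_mul, Polynomial.eval_sub, Polynomial.eval_pow,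
    Polynomial.eval_X]
  field_simp
  ring

lemma hasDerivAt_cotDeriv (j : ℕ) {w : ℂ} (hw : qexp w ≠ 1) :
    HasDerivAt (cotDeriv j) (2 * Real.pi * Complex.I * cotDeriv (j + 1) w) w :=
  hasDerivAt_polylog_comp j (hasDerivAt_qexp w) hw

lemma differentiableAt_polylog (j : ℕ) {x : ℂ} (hx : x ≠ 1) :
    DifferentiableAt ℂ (polylog j) x := by
  have h1 : 1 - x ≠ 0 := sub_ne_zero.2 hx.symm
  unfold polylog
  have : DifferentiableAt ℂ (fun x : ℂ => 1 / (1 - x)) x := by fun_prop (disch := assumption)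
  exact ((polylogPoly j).differentiableAt.comp x this).sub_const _

@[simp] lemma polylog_zero_right (j : ℕ) : polylog j 0 = 0 := by simp [polylog]

/-- Mean value inequality on a disc that avoids the only pole `1`, starting from the zero at the
origin. -/
lemma exists_norm_polylog_le (j : ℕ) :
    ∃ C, 0 ≤ C ∧ ∀ x : ℂ, ‖x‖ ≤ 1 / 2 → ‖polylog j x‖ ≤ C * ‖x‖ := by
  have hne : ∀ x ∈ Metric.closedBall (0 : ℂ) (1 / 2), x ≠ 1 := by
    rintro x hx rfl
    norm_num at hx
  have hd : ∀ x ∈ Metric.closedBall (0 : ℂ) (1 / 2), DifferentiableAt ℂ (polylog j) x :=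
    fun x hx => differentiableAt_polylog j (hne x hx)
  have hC : ContDiffOn ℂ 1 (polylog j) {1}ᶜ :=
    DifferentiableOn.contDiffOn
      (fun x hx => (differentiableAt_polylog j hx).differentiableWithinAt) isOpen_compl_singleton
  have hcont : ContinuousOn (deriv (polylog j)) (Metric.closedBall (0 : ℂ) (1 / 2)) :=
    (hC.continuousOn_deriv_of_isOpen isOpen_compl_singleton le_rfl).mono hne
  obtain ⟨C, hC⟩ := (isCompact_closedBall (0 : ℂ) (1 / 2)).exists_bound_of_continuousOn hcont
  have h0 : (0 : ℂ) ∈ Metric.closedBall (0 : ℂ) (1 / 2) := by simp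
  refine ⟨C, (norm_nonneg _).trans (hC 0 h0), fun x hx => ?_⟩
  have := (convex_closedBall (0 : ℂ) (1 / 2)).norm_image_sub_le_of_norm_deriv_le hd hC h0
    (y := x) (by simpa using hx)
  simpa using this

/-! ### Lambert series -/

/-- The Lambert series `∑_{n ≥ 1} Li_{-j}(x qⁿ)`. -/
def lambert (j : ℕ) (x q : ℂ) : ℂ := ∑' n : ℕ, polylog j (x * q ^ (n + 1))

/-- On a compact set the arguments are at most `A r^(n+1)` with `r < 1`, hence eventually in the
disc of radius `1/2`, where `polylog` is linearly bounded; poles of the first few terms are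
harmless. Letting both `a` and `b` vary allows differentiation in `z`, holomorphy in `τ` and plain
summability to be read off. -/
lemma summableLocallyUniformlyOn_polylog (j : ℕ) {U : Set ℂ} (hU : IsOpen U) {a b : ℂ → ℂ}
    (ha : ContinuousOn a U) (hb : ContinuousOn b U) (hb1 : ∀ s ∈ U, ‖b s‖ < 1) :
    SummableLocallyUniformlyOn (fun (n : ℕ) s => polylog j (a s * b s ^ (n + 1))) U := by
  refine SummableLocallyUniformlyOn.of_locally_bounded_eventually hU fun K hKU hK => ?_
  rcases K.eq_empty_or_nonempty with rfl | hKne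
  · exact ⟨0, summable_zero, by simp⟩
  obtain ⟨A, hA⟩ := hK.exists_bound_of_continuousOn (ha.mono hKU)
  obtain ⟨s₀, hs₀, hmax⟩ := hK.exists_isMaxOn hKne (hb.mono hKU).norm
  set r := ‖b s₀‖
  have hr0 : 0 ≤ r := norm_nonneg _
  have hr1 : r < 1 := hb1 _ (hKU hs₀)
  obtain ⟨C, hC0, hC⟩ := exists_norm_polylog_le j
  have hlim : Tendsto (fun n : ℕ => A * r ^ (n + 1)) atTop (𝓝 0) := by
    simpa using ((tendsto_pow_atTop_nhds_zero_of_lt_one hr0 hr1).comp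
      (tendsto_add_atTop_nat 1)).const_mul A
  refine ⟨fun n => C * (A * r ^ (n + 1)), ?_, ?_⟩
  · exact (((summable_nat_add_iff 1).2 (summable_geometric_of_lt_one hr0 hr1)).mul_left A).mul_left C
  · rw [Nat.cofinite_eq_atTop]
    filter_upwards [hlim.eventually_le_const (show (0 : ℝ) < 1 / 2 by norm_num)] with n hn s hs
    have hle : ‖a s * b s ^ (n + 1)‖ ≤ A * r ^ (n + 1) := by
      rw [norm_mul, norm_pow]
      have h1 : ‖b s‖ ≤ r := hmax hs
      have h2 := hA s hs
      have h3 : 0 ≤ A := (norm_nonneg _).trans h2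
      gcongr
    exact (hC _ (hle.trans hn)).trans (by gcongr)

lemma summable_polylog (j : ℕ) (x : ℂ) {q : ℂ} (hq : ‖q‖ < 1) :
    Summable fun n : ℕ => polylog j (x * q ^ (n + 1)) :=
  (summableLocallyUniformlyOn_polylog j isOpen_univ (a := fun _ => x) (b := fun _ => q)
    continuousOn_const continuousOn_const (fun _ _ => hq)).summable (Set.mem_univ 0)

lemma isOpen_forall_mul_pow_ne_one {q : ℂ} (hq : ‖q‖ < 1) :
    IsOpen {x : ℂ | ∀ n : ℕ, x * q ^ (n + 1) ≠ 1} := by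
  rw [isOpen_iff_mem_nhds]
  intro x₀ hx₀
  have hlim : Tendsto (fun n : ℕ => (‖x₀‖ + 1) * ‖q‖ ^ (n + 1)) atTop (𝓝 0) := by
    simpa using ((tendsto_pow_atTop_nhds_zero_of_lt_one (norm_nonneg q) hq).comp
      (tendsto_add_atTop_nat 1)).const_mul (‖x₀‖ + 1)
  obtain ⟨n₀, hn₀⟩ := eventually_atTop.1 (hlim.eventually_lt_const (show (0 : ℝ) < 1 by norm_num))
  have h1 : ∀ᶠ x in 𝓝 x₀, ‖x‖ < ‖x₀‖ + 1 :=
    continuous_norm.continuousAt.eventually_lt_const (by linarith)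
  have h2 : ∀ᶠ x in 𝓝 x₀, ∀ n ∈ Set.Iio n₀, x * q ^ (n + 1) ≠ 1 := by
    rw [eventually_all_finite (Set.finite_Iio n₀)]
    intro n _
    exact (continuous_mul_const _).continuousAt.eventually_ne (hx₀ n)
  filter_upwards [h1, h2] with x hx hx2 n
  rcases lt_or_ge n n₀ with h | h
  · exact hx2 n h
  · intro h3
    have h4 := hn₀ n h
    have h5 : ‖x * q ^ (n + 1)‖ ≤ (‖x₀‖ + 1) * ‖q‖ ^ (n + 1) := by
      rw [norm_mul, norm_pow]
      gcongr
    rw [h3, norm_one] at h5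
    linarith

lemma hasDerivAt_lambert_qexp (j : ℕ) {q : ℂ} (hq : ‖q‖ < 1) {z : ℂ}
    (hz : ∀ n : ℕ, qexp z * q ^ (n + 1) ≠ 1) :
    HasDerivAt (fun z => lambert j (qexp z) q)
      (2 * Real.pi * Complex.I * lambert (j + 1) (qexp z) q) z := by
  set U := {z : ℂ | ∀ n : ℕ, qexp z * q ^ (n + 1) ≠ 1}
  have hU : IsOpen U := (isOpen_forall_mul_pow_ne_one hq).preimage differentiable_qexp.continuous
  have hs := summableLocallyUniformlyOn_polylog (j + 1) hU (a := qexp) (b := fun _ => q)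
    differentiable_qexp.continuous.continuousOn continuousOn_const (fun _ _ => hq)
  have hd : ∀ (n : ℕ), ∀ y ∈ U, HasDerivAt (fun z => polylog j (qexp z * q ^ (n + 1)))
      (2 * Real.pi * Complex.I * polylog (j + 1) (qexp y * q ^ (n + 1))) y := by
    intro n y hy
    have h1 : HasDerivAt (fun z => qexp z * q ^ (n + 1))
        (2 * Real.pi * Complex.I * (qexp y * q ^ (n + 1))) y := by
      rw [← mul_assoc]
      exact (hasDerivAt_qexp y).mul_const _
    have h2 := (hasDerivAt_polylog_comp j h1 (hy n)).sub_const ((polylogPoly j).eval 1)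
    have h3 : (polylogPoly (j + 1)).eval 1 = 0 := by simp [polylogPoly]
    simpa only [polylog, h3, sub_zero] using! h2
  have hs' := (hasSumLocallyUniformlyOn_iff_tendstoLocallyUniformlyOn.mp
    hs.hasSumLocallyUniformlyOn)
  -- Dividing by `2πi` makes the termwise derivatives exactly the partial sums of the next Lambert
  -- series, whose convergence is known.
  have := hasDerivAt_of_tendstoLocallyUniformlyOn hU
    (f := fun (t : Finset ℕ) z => (2 * Real.pi * Complex.I)⁻¹ * ∑ n ∈ t, polylog j (qexp z * q ^ (n + 1)))
    (f' := fun t z => ∑ n ∈ t, polylog (j + 1) (qexp z * q ^ (n + 1)))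
    (g := fun z => (2 * Real.pi * Complex.I)⁻¹ * lambert j (qexp z) q) hs'
    (Eventually.of_forall fun t y hy => by
      have := (HasDerivAt.fun_sum fun n (_ : n ∈ t) => hd n y hy).const_mul
        (2 * Real.pi * Complex.I)⁻¹
      rwa [← Finset.mul_sum, inv_mul_cancel_left₀ Complex.two_pi_I_ne_zero] at this)
    (fun y _ => Tendsto.const_mul _ (summable_polylog j (qexp y) hq).hasSum) (show z ∈ U from hz)
  have h2 := this.const_mul (2 * Real.pi * Complex.I)
  simpa only [mul_inv_cancel_left₀ Complex.two_pi_I_ne_zero] using! h2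

lemma differentiableOn_lambert_qexp (j : ℕ) {x : ℂ} (hx : ‖x‖ = 1) :
    DifferentiableOn ℂ (fun τ => lambert j x (qexp τ)) {τ | 0 < τ.im} := by
  have hU : IsOpen {τ : ℂ | 0 < τ.im} := isOpen_lt continuous_const Complex.continuous_im
  refine (summableLocallyUniformlyOn_polylog j hU (a := fun _ => x) (b := qexp) continuousOn_const
    differentiable_qexp.continuous.continuousOn
    (fun τ hτ => norm_qexp_lt_one hτ)).differentiableOn hU fun n τ hτ => ?_
  have h1 : x * qexp τ ^ (n + 1) ≠ 1 := by
    intro h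
    have h2 := congrArg norm h
    rw [norm_mul, hx, norm_pow, one_mul, norm_one] at h2
    exact (pow_lt_one₀ (norm_nonneg _) (norm_qexp_lt_one hτ) (Nat.succ_ne_zero n)).ne h2
  have h2 : DifferentiableAt ℂ (fun τ => x * qexp τ ^ (n + 1)) τ :=
    ((differentiable_qexp τ).pow _).const_mul x
  exact (differentiableAt_polylog j h1).comp τ h2

lemma lambert_mul_self (j : ℕ) (x : ℂ) {q : ℂ} (hq : ‖q‖ < 1) :
    lambert j x q = polylog j (x * q) + lambert j (x * q) q := by
  rw [lambert, (summable_polylog j x hq).tsum_eq_zero_add, lambert]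
  congr 1
  · simp
  · refine tsum_congr fun n => ?_
    ring_nf

/-! ### Period lattices and Liouville's theorem -/

/-- The pair of periods `(1, τ)`. -/
def periods (τ : ℍ) : PeriodPair where
  ω₁ := 1
  ω₂ := τ
  indep := by
    rw [LinearIndependent.pair_iff]
    intro s t h
    have h1 := congrArg Complex.im h
    have h2 := congrArg Complex.re h
    simp at h1 h2
    rcases h1 with rfl | h1
    · simpa using h2
    · exact absurd h1 τ.im_ne_zero

lemma mem_lattice_periods {τ : ℍ} {z : ℂ} :
    z ∈ (periods τ).lattice ↔ ∃ m n : ℤ, (m : ℂ) + n * τ = z := by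
  simp [PeriodPair.mem_lattice, periods]

section Liouville

variable {L : PeriodPair} {D : ℂ → ℂ}

/-- A function, holomorphic and periodic off a lattice with removable singularities on it, is
constant. -/
lemma exists_eq_const_of_periodic
    (hd : ∀ z ∉ L.lattice, DifferentiableAt ℂ D z)
    (hper : ∀ l ∈ L.lattice, ∀ z ∉ L.lattice, D (z + l) = D z)
    {g : ℂ → ℂ} (hg : DifferentiableAt ℂ g 0) (hDg : ∀ᶠ z in 𝓝[≠] 0, D z = g z) :
    ∃ c, ∀ z ∉ L.lattice, D z = c := by
  classical
  set F : ℂ → ℂ := fun z => if z ∈ L.lattice then g 0 else D z with hF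
  have hFper : ∀ l ∈ L.lattice, ∀ z, F (z + l) = F z := by
    intro l hl z
    simp only [hF, Submodule.add_mem_iff_left _ hl]
    split_ifs with h
    · rfl
    · exact hper l hl z h
  have h0 : DifferentiableAt ℂ F 0 := by
    refine hg.congr_of_eventuallyEq ?_
    have h1 : ∀ᶠ z in 𝓝 (0 : ℂ), z ∈ (↑L.lattice \ {0} : Set ℂ)ᶜ :=
      L.compl_lattice_sdiff_singleton_mem_nhds 0
    filter_upwards [h1, eventually_nhdsWithin_iff.1 hDg] with z hz hz2
    by_cases hz0 : z = 0
    · simp [hF, hz0]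
    · have : z ∉ L.lattice := fun h => hz ⟨h, hz0⟩
      simp only [hF, this, if_false]
      exact hz2 hz0
  have hFd : Differentiable ℂ F := by
    intro z
    by_cases hz : z ∈ L.lattice
    · have h1 : F = fun w => F (w - z) := by
        funext w
        rw [sub_eq_add_neg, hFper _ (neg_mem hz)]
      rw [h1]
      have h2 : DifferentiableAt ℂ F (z - z) := by rwa [sub_self]
      exact DifferentiableAt.comp (f := fun w => w - z) z h2 (differentiableAt_id.sub_const z)
    · refine (hd z hz).congr_of_eventuallyEq ?_
      filter_upwards [L.isClosed_lattice.isOpen_compl.mem_nhds hz] with w hw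
      have : w ∉ L.lattice := hw
      simp [hF, this]
  -- Periodicity reduces every value of `F` to one on the closure of a fundamental domain, which is
  -- compact.
  have hb : Bornology.IsBounded (Set.range F) := by
    have hc := (ZSpan.fundamentalDomain_isBounded L.basis).isCompact_closure
    refine (hc.image hFd.continuous).isBounded.subset ?_
    rintro _ ⟨z, rfl⟩
    refine ⟨ZSpan.fract L.basis z, subset_closure (ZSpan.fract_mem_fundamentalDomain _ _), ?_⟩
    rw [ZSpan.fract_apply, sub_eq_add_neg]
    refine hFper _ (neg_mem ?_) z
    rw [L.lattice_eq_span_range_basis]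
    exact (ZSpan.floor L.basis z).2
  obtain ⟨c, hc⟩ := hFd.exists_const_forall_eq_of_bounded hb
  refine ⟨c, fun z hz => ?_⟩
  have := hc z
  simpa [hF, hz] using this

end Liouville

/-! ### The cotangent sum: derivatives, parity, periods and principal part -/

/-- `(2πi)⁻ʲ d^j/dz^j` of `(i/2) ∑_n cot (π(z + nτ))`. -/
def zetaDeriv (j : ℕ) (z : ℂ) (τ : ℍ) : ℂ :=
  cotDeriv j z + (lambert j (qexp z) (qexp τ) + (-1) ^ (j + 1) * lambert j (qexp (-z)) (qexp τ))

section

variable {τ : ℍ} {z : ℂ}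

lemma norm_qexp_coe_lt_one (τ : ℍ) : ‖qexp τ‖ < 1 := norm_qexp_lt_one τ.im_pos

lemma qexp_ne_one (hz : z ∉ (periods τ).lattice) : qexp z ≠ 1 := by
  rw [Ne, qexp_eq_one_iff]
  rintro ⟨n, rfl⟩
  exact hz (mem_lattice_periods.2 ⟨n, 0, by simp⟩)

lemma qexp_mul_pow_ne_one (hz : z ∉ (periods τ).lattice) (n : ℕ) :
    qexp z * qexp τ ^ (n + 1) ≠ 1 := by
  rw [← qexp_nat_mul, ← qexp_add, Ne, qexp_eq_one_iff]
  rintro ⟨m, h⟩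
  refine hz (mem_lattice_periods.2 ⟨m, -((n + 1 : ℕ) : ℤ), ?_⟩)
  push_cast at h ⊢
  linear_combination -h

lemma qexp_neg_mul_pow_ne_one (hz : z ∉ (periods τ).lattice) (n : ℕ) :
    qexp (-z) * qexp τ ^ (n + 1) ≠ 1 :=
  qexp_mul_pow_ne_one (fun h => hz (by simpa using neg_mem h)) n

lemma hasDerivAt_zetaDeriv_aux (j : ℕ) (hz1 : ∀ n : ℕ, qexp z * qexp τ ^ (n + 1) ≠ 1)
    (hz2 : ∀ n : ℕ, qexp (-z) * qexp τ ^ (n + 1) ≠ 1) :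
    HasDerivAt (fun z => lambert j (qexp z) (qexp τ) +
        (-1) ^ (j + 1) * lambert j (qexp (-z)) (qexp τ))
      (2 * Real.pi * Complex.I * (lambert (j + 1) (qexp z) (qexp τ) +
        (-1) ^ (j + 2) * lambert (j + 1) (qexp (-z)) (qexp τ))) z := by
  have h1 := hasDerivAt_lambert_qexp j (norm_qexp_coe_lt_one τ) hz1
  have h2 := (hasDerivAt_lambert_qexp j (norm_qexp_coe_lt_one τ) hz2).comp z (hasDerivAt_neg z)
  convert! h1.add (h2.const_mul ((-1) ^ (j + 1))) using 1
  ring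

lemma hasDerivAt_zetaDeriv (j : ℕ) (hz : z ∉ (periods τ).lattice) :
    HasDerivAt (fun z => zetaDeriv j z τ) (2 * Real.pi * Complex.I * zetaDeriv (j + 1) z τ) z := by
  convert! (hasDerivAt_cotDeriv j (qexp_ne_one hz)).add
    (hasDerivAt_zetaDeriv_aux j (qexp_mul_pow_ne_one hz) (qexp_neg_mul_pow_ne_one hz)) using 1
  simp only [zetaDeriv]
  ring

lemma zetaDeriv_add_one (j : ℕ) (z : ℂ) (τ : ℍ) : zetaDeriv j (z + 1) τ = zetaDeriv j z τ := by
  have h : qexp (-(z + 1)) = qexp (-z) := by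
    rw [qexp_neg, qexp_neg, qexp_add, qexp_one, mul_one]
  rw [zetaDeriv, h, cotDeriv_add_one, qexp_add, qexp_one, mul_one, zetaDeriv]

lemma zetaDeriv_neg (j : ℕ) (hz : z ∉ (periods τ).lattice) :
    zetaDeriv j (-z) τ = (-1) ^ (j + 1) * zetaDeriv j z τ := by
  have h : ((-1 : ℂ) ^ (j + 1)) * (-1) ^ (j + 1) = 1 := by
    rw [← mul_pow]; simp
  rw [zetaDeriv, zetaDeriv, cotDeriv_neg j (qexp_ne_one hz), neg_neg]
  linear_combination (-lambert j (qexp (-z)) (qexp τ)) * h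

/-- The shift moves one term from one Lambert series into the cotangent and the cotangent into the
other series. What remains is `(1 + (-1)^j)` times the constant of `cotDeriv`: for `j = 0` the
difference of the limits `±1/2` of the cotangent at `±i∞`, otherwise nothing. -/
lemma zetaDeriv_add_tau (j : ℕ) (hz : z ∉ (periods τ).lattice) :
    zetaDeriv j (z + τ) τ = zetaDeriv j z τ + if j = 0 then 1 else 0 := by
  have hq := norm_qexp_coe_lt_one τ
  have h1 := lambert_mul_self j (qexp z) hq
  have h2 := lambert_mul_self j (qexp (-(z + τ))) hq
  have h3 := cotDeriv_neg j (qexp_ne_one hz)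
  have h4 := polylogPoly_eval_one_mul' j
  have h5 : qexp (-(z + τ)) * qexp τ = qexp (-z) := by
    rw [← qexp_add]; ring_nf
  have h6 : ((-1 : ℂ) ^ j) * (-1) ^ j = 1 := by
    rw [← mul_pow]; simp
  rw [h5] at h2
  rw [zetaDeriv, zetaDeriv, cotDeriv_eq j (z + τ), qexp_add, h1, h2]
  rw [cotDeriv_eq j (-z)] at h3
  rw [pow_succ] at h3 ⊢
  linear_combination h4 - (-1) ^ j * h3 + cotDeriv j z * h6

lemma add_mul_int_of_add {L : PeriodPair} {f : ℂ → ℂ} {ω c : ℂ} (hω : ω ∈ L.lattice)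
    (hf : ∀ z ∉ L.lattice, f (z + ω) = f z + c) (n : ℤ) :
    ∀ z ∉ L.lattice, f (z + n * ω) = f z + n * c := by
  induction n using Int.induction_on with
  | zero => simp
  | succ n ih =>
    intro z hz
    have h1 : z + (n : ℤ) * ω ∉ L.lattice := by
      rw [← zsmul_eq_mul, Submodule.add_mem_iff_left _ (zsmul_mem hω _)]; exact hz
    have h2 := hf _ h1
    rw [ih z hz] at h2
    push_cast at h2 ⊢
    rw [add_mul, one_mul, ← add_assoc, h2]
    ring
  | pred n ih =>
    intro z hz
    have h1 : z + ((-(n : ℤ) - 1 : ℤ) : ℂ) * ω ∉ L.lattice := by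
      rw [← zsmul_eq_mul, Submodule.add_mem_iff_left _ (zsmul_mem hω _)]; exact hz
    have h2 := hf _ h1
    have h3 := ih z hz
    push_cast at h2 h3 ⊢
    have h4 : z + (-(n : ℂ) - 1) * ω + ω = z + -(n : ℂ) * ω := by ring
    rw [h4, h3] at h2
    linear_combination -h2

lemma zetaDeriv_add_period (j : ℕ) (hz : z ∉ (periods τ).lattice) (m n : ℤ) :
    zetaDeriv j (z + (m + n * τ)) τ = zetaDeriv j z τ + if j = 0 then (n : ℂ) else 0 := by
  have h1 : (1 : ℂ) ∈ (periods τ).lattice := (periods τ).ω₁_mem_lattice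
  have h2 : (τ : ℂ) ∈ (periods τ).lattice := (periods τ).ω₂_mem_lattice
  have h3 := add_mul_int_of_add (f := fun z => zetaDeriv j z τ) (c := 0) h1
    (fun z _ => by rw [zetaDeriv_add_one, add_zero]) m z hz
  have h4 := add_mul_int_of_add (f := fun z => zetaDeriv j z τ) h2
    (fun z hz => zetaDeriv_add_tau j hz) n (z + m * 1) (by
      rw [← zsmul_eq_mul, Submodule.add_mem_iff_left _ (zsmul_mem h1 _)]; exact hz)
  simp only [mul_one, mul_zero, add_zero] at h3 h4
  rw [← add_assoc, h4, h3]
  simp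

end

lemma analyticAt_dslope {f : ℂ → ℂ} {a : ℂ} (hf : AnalyticAt ℂ f a) :
    AnalyticAt ℂ (dslope f a) a := by
  obtain ⟨p, hp⟩ := hf
  exact ⟨_, hp.has_fpower_series_dslope_fslope⟩

/-- The principal part of `cotDeriv j` at `0`. -/
lemma exists_cotDeriv_eq_add (j : ℕ) : ∃ (A : ℂ) (t : ℂ → ℂ), AnalyticAt ℂ t 0 ∧
    ∀ᶠ z in 𝓝[≠] 0, cotDeriv j z = A / z ^ (j + 1) + t z := by
  induction j with
  | zero =>
    have hq : AnalyticAt ℂ qexp 0 := differentiable_qexp.analyticAt 0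
    have hh := analyticAt_dslope hq
    set h := dslope qexp 0
    have hh0 : h 0 ≠ 0 := by
      rw [show h 0 = deriv qexp 0 from dslope_same _ _, (hasDerivAt_qexp 0).deriv]
      simp [Real.pi_ne_zero]
    have hk : AnalyticAt ℂ (fun z => (h z)⁻¹) 0 := hh.inv hh0
    -- Here `1/(1 - qexp z) = -1/(z h(z))`, and `1/h` is its value at `0` plus `z` times its own
    -- slope; the `1/2` is the constant in `polylogPoly 0`.
    refine ⟨-(h 0)⁻¹, fun z => -(dslope (fun z => (h z)⁻¹) 0 z) - 1 / 2,
      (analyticAt_dslope hk).neg.sub analyticAt_const, ?_⟩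
    have h1 : ∀ᶠ z in 𝓝[≠] (0 : ℂ), h z ≠ 0 :=
      (hh.continuousAt.eventually_ne hh0).filter_mono nhdsWithin_le_nhds
    filter_upwards [h1, self_mem_nhdsWithin] with z hz hz0
    have hz0 : z ≠ 0 := hz0
    have h2 : z * h z = qexp z - 1 := by
      have := sub_smul_dslope qexp 0 z
      simpa using this
    have h3 : z * dslope (fun z => (h z)⁻¹) 0 z = (h z)⁻¹ - (h 0)⁻¹ := by
      have := sub_smul_dslope (fun z => (h z)⁻¹) 0 z
      simpa using this
    have h4 : 1 - qexp z = -(z * h z) := by rw [h2]; ring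
    have h5 : dslope (fun z => (h z)⁻¹) 0 z = ((h z)⁻¹ - (h 0)⁻¹) / z := by
      rw [← h3]; field_simp
    rw [cotDeriv, h4, h5]
    simp [polylogPoly]
    field_simp
    ring
  | succ j ih =>
    obtain ⟨A, t, ht, hAt⟩ := ih
    -- Obtained by differentiating the previous expansion and dividing by `2πi`.
    refine ⟨-(2 * Real.pi * Complex.I)⁻¹ * (j + 1) * A,
      fun z => (2 * Real.pi * Complex.I)⁻¹ * deriv t z, analyticAt_const.mul ht.deriv, ?_⟩
    have h1 : ∀ᶠ z in 𝓝[≠] (0 : ℂ), AnalyticAt ℂ t z :=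
      ht.eventually_analyticAt.filter_mono nhdsWithin_le_nhds
    have h2 : ∀ᶠ z in 𝓝[≠] (0 : ℂ), ‖z‖ < 1 :=
      (continuous_norm.continuousAt.eventually_lt_const (by simp)).filter_mono nhdsWithin_le_nhds
    filter_upwards [eventually_eventually_nhdsWithin.2 hAt, h1, h2, self_mem_nhdsWithin]
      with z hz hzt hz1 hz0
    rw [isOpen_compl_singleton.nhdsWithin_eq hz0] at hz
    have hz0 : z ≠ 0 := hz0
    have hq : qexp z ≠ 1 := by
      rw [Ne, qexp_eq_one_iff]
      rintro ⟨n, rfl⟩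
      rw [Complex.norm_intCast] at hz1
      have : |n| < 1 := by exact_mod_cast hz1
      exact hz0 (by simp [Int.abs_lt_one_iff.1 this])
    have h3 := hasDerivAt_cotDeriv j hq
    have h4 : HasDerivAt (fun z : ℂ => A / z ^ (j + 1)) (-((j + 1) * A / z ^ (j + 2))) z := by
      have := (hasDerivAt_const z A).div (hasDerivAt_pow (j + 1) z) (pow_ne_zero _ hz0)
      convert! this using 1
      push_cast
      field_simp
      simp
      ring
    have h5 := (h4.add hzt.differentiableAt.hasDerivAt)
    have h6 := h3.unique (h5.congr_of_eventuallyEq hz)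
    have h7 := Complex.two_pi_I_ne_zero
    rw [← inv_mul_cancel_left₀ h7 (cotDeriv (j + 1) z), h6]
    ring

/-! ### The modular transformation law -/

section

variable (γ : SL(2, ℤ)) (τ : ℍ)

/-- The automorphy factor `cτ + d`. -/
def autFactor : ℂ := (γ 1 0 : ℂ) * τ + (γ 1 1 : ℂ)

lemma autFactor_ne_zero : autFactor γ τ ≠ 0 := by
  have := UpperHalfPlane.denom_ne_zero (γ : GL (Fin 2) ℝ) τ
  simpa [autFactor, UpperHalfPlane.denom] using this

lemma autFactor_mul_smul :
    autFactor γ τ * (γ • τ : ℍ) = (γ 0 0 : ℂ) * τ + (γ 0 1 : ℂ) := by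
  have h := UpperHalfPlane.coe_specialLinearGroup_apply γ τ
  have h0 := autFactor_ne_zero γ τ
  simp only [algebraMap_int_eq, eq_intCast, Complex.ofReal_intCast] at h
  rw [h, ← autFactor]
  field_simp

lemma det_coe_eq_one : (γ 0 0 : ℂ) * γ 1 1 - (γ 0 1 : ℂ) * γ 1 0 = 1 := by
  have := γ.det_coe
  rw [Matrix.det_fin_two] at this
  exact_mod_cast this

variable {γ τ}

lemma div_autFactor_notMem {z : ℂ} (hz : z ∉ (periods τ).lattice) :
    z / autFactor γ τ ∉ (periods (γ • τ)).lattice := by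
  intro h
  obtain ⟨m, n, h⟩ := mem_lattice_periods.1 h
  have h0 := autFactor_ne_zero γ τ
  have h1 := autFactor_mul_smul γ τ
  refine hz (mem_lattice_periods.2 ⟨m * γ 1 1 + n * γ 0 1, m * γ 1 0 + n * γ 0 0, ?_⟩)
  rw [eq_div_iff h0] at h
  push_cast
  have h2 : autFactor γ τ = (γ 1 0 : ℂ) * τ + (γ 1 1 : ℂ) := rfl
  linear_combination h - m * h2 - n * h1

/-- The difference `D` of the two sides is elliptic for the lattice of `τ`, because the linear term
absorbs the mismatch of the quasi-periods. Its poles at lattice points cancel, so it is constant,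
and it is odd, so it vanishes. -/
lemma zetaDeriv_zero_smul {z : ℂ} (hz : z ∉ (periods τ).lattice) :
    (autFactor γ τ)⁻¹ * zetaDeriv 0 (z / autFactor γ τ) (γ • τ)
      = zetaDeriv 0 z τ - γ 1 0 * (z / autFactor γ τ) := by
  have h0 := autFactor_ne_zero γ τ
  have h1 := autFactor_mul_smul γ τ
  have hdet := det_coe_eq_one γ
  set l := autFactor γ τ with hl
  have hl' : l = (γ 1 0 : ℂ) * τ + (γ 1 1 : ℂ) := rfl
  set D : ℂ → ℂ := fun z => l⁻¹ * zetaDeriv 0 (z / l) (γ • τ) - zetaDeriv 0 z τ + γ 1 0 * (z / l)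
    with hD
  have hd : ∀ z ∉ (periods τ).lattice, DifferentiableAt ℂ D z := by
    intro z hz
    have h2 : DifferentiableAt ℂ (fun z => zetaDeriv 0 (z / l) (γ • τ)) z :=
      DifferentiableAt.comp (f := fun z => z / l) (g := fun z => zetaDeriv 0 z (γ • τ)) z
        (hasDerivAt_zetaDeriv 0 (div_autFactor_notMem hz)).differentiableAt
        (differentiableAt_id.div_const l)
    exact ((h2.const_mul _).sub (hasDerivAt_zetaDeriv 0 hz).differentiableAt).add
      ((differentiableAt_id.div_const l).const_mul _)
  have hper : ∀ p ∈ (periods τ).lattice, ∀ z ∉ (periods τ).lattice, D (z + p) = D z := by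
    intro p hp z hz
    obtain ⟨m, n, rfl⟩ := mem_lattice_periods.1 hp
    -- The coordinates of the period in the basis `1, γτ` of the rescaled lattice come from
    -- inverting `γ`.
    have h2 : (z + (m + n * τ)) / l = z / l + (((m * γ 0 0 - n * γ 0 1 : ℤ) : ℂ)
        + ((n * γ 1 1 - m * γ 1 0 : ℤ) : ℂ) * (γ • τ : ℍ)) := by
      field_simp
      push_cast
      linear_combination (-(n * γ 1 1 - m * γ 1 0) : ℂ) * h1 - (m * γ 0 0 - n * γ 0 1) * hl'
        - (m + n * τ) * hdet
    have h3 := zetaDeriv_add_period 0 (div_autFactor_notMem (γ := γ) hz)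
      (m * γ 0 0 - n * γ 0 1) (n * γ 1 1 - m * γ 1 0)
    have h4 := zetaDeriv_add_period 0 hz m n
    rw [← hl, ← h2] at h3
    simp only [hD]
    rw [h3, h4]
    simp only [if_true]
    push_cast
    linear_combination (n : ℂ) * inv_mul_cancel₀ h0 - l⁻¹ * n * hl'
  obtain ⟨A, t, ht, hAt⟩ := exists_cotDeriv_eq_add 0
  -- `g` is `D` with the principal parts dropped: `l⁻¹ · A/(z/l) = A/z` for `l = cτ + d`.
  set g : ℂ → ℂ := fun z => l⁻¹ * (t (z / l) + (lambert 0 (qexp (z / l)) (qexp (γ • τ : ℍ)) +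
        (-1) ^ (0 + 1) * lambert 0 (qexp (-(z / l))) (qexp (γ • τ : ℍ)))) -
      (t z + (lambert 0 (qexp z) (qexp τ) + (-1) ^ (0 + 1) * lambert 0 (qexp (-z)) (qexp τ)))
      + γ 1 0 * (z / l) with hg
  have hreg : ∀ τ : ℍ, DifferentiableAt ℂ (fun z => t z + (lambert 0 (qexp z) (qexp τ) +
      (-1) ^ (0 + 1) * lambert 0 (qexp (-z)) (qexp τ))) 0 := by
    intro τ
    have h2 : ∀ n : ℕ, qexp (0 : ℂ) * qexp τ ^ (n + 1) ≠ 1 := by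
      intro n h
      have h3 := congrArg norm h
      rw [qexp_zero, one_mul, norm_pow, norm_one] at h3
      exact (pow_lt_one₀ (norm_nonneg _) (norm_qexp_coe_lt_one τ) (Nat.succ_ne_zero n)).ne h3
    exact ht.differentiableAt.add
      (hasDerivAt_zetaDeriv_aux 0 h2 (by rwa [neg_zero])).differentiableAt
  have hgd : DifferentiableAt ℂ g 0 := by
    have h2 : DifferentiableAt ℂ (fun z : ℂ => z / l) 0 := differentiableAt_id.div_const l
    have h3 := hreg (γ • τ)
    rw [← zero_div l] at h3
    exact (((DifferentiableAt.comp (0 : ℂ) h3 h2).const_mul l⁻¹).sub (hreg τ)).add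
      (h2.const_mul _)
  have hDg : ∀ᶠ z in 𝓝[≠] 0, D z = g z := by
    have h2 : Tendsto (fun z : ℂ => z / l) (𝓝[≠] 0) (𝓝[≠] 0) := by
      refine tendsto_nhdsWithin_iff.2 ⟨?_, ?_⟩
      · have : Tendsto (fun z : ℂ => z / l) (𝓝 0) (𝓝 (0 / l)) :=
          (continuous_id.div_const l).continuousAt
        rw [zero_div] at this
        exact this.mono_left nhdsWithin_le_nhds
      · filter_upwards [self_mem_nhdsWithin] with z hz
        exact div_ne_zero hz h0
    filter_upwards [hAt, h2.eventually hAt, self_mem_nhdsWithin] with z hz1 hz2 hz0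
    have hz0 : z ≠ 0 := hz0
    simp only [hD, hg, zetaDeriv, hz1, hz2]
    have h3 : l⁻¹ * (A / (z / l) ^ (0 + 1)) = A / z ^ (0 + 1) := by
      rw [zero_add, pow_one, pow_one]
      field_simp
    linear_combination h3
  obtain ⟨κ, hκ⟩ := exists_eq_const_of_periodic hd hper hgd hDg
  have hz' : -z ∉ (periods τ).lattice := fun h => hz (by simpa using neg_mem h)
  have e1 := hκ z hz
  have e2 := hκ (-z) hz'
  simp only [hD] at e1 e2
  rw [neg_div, zetaDeriv_neg 0 hz, zetaDeriv_neg 0 (div_autFactor_notMem hz)] at e2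
  have e3 : κ = 0 := by
    have : 2 * κ = 0 := by linear_combination -e1 - e2
    simpa using this
  rw [e3] at e1
  linear_combination e1

/-- The modular transformation of `zetaDeriv j`. -/
lemma zetaDeriv_smul (j : ℕ) : ∀ z ∉ (periods τ).lattice,
    (autFactor γ τ)⁻¹ ^ (j + 1) * zetaDeriv j (z / autFactor γ τ) (γ • τ) = zetaDeriv j z τ -
      (if j = 0 then γ 1 0 * (z / autFactor γ τ) else
        if j = 1 then (2 * Real.pi * Complex.I)⁻¹ * (γ 1 0 / autFactor γ τ) else 0) := by
  have hI := Complex.two_pi_I_ne_zero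
  induction j with
  | zero =>
    intro z hz
    simpa using zetaDeriv_zero_smul hz
  | succ j ih =>
    intro z hz
    set l := autFactor γ τ with hl
    have h1 : HasDerivAt (fun z => l⁻¹ ^ (j + 1) * zetaDeriv j (z / l) (γ • τ))
        (l⁻¹ ^ (j + 1) * (2 * Real.pi * Complex.I * zetaDeriv (j + 1) (z / l) (γ • τ) * (1 / l)))
        z := by
      refine HasDerivAt.const_mul _ ?_
      exact HasDerivAt.comp (h := fun z => z / l) z
        (hasDerivAt_zetaDeriv j (div_autFactor_notMem hz)) ((hasDerivAt_id z).div_const l)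
    -- The anomaly is linear in `z` for `j = 0`, so one differentiation makes it constant and a
    -- second one kills it.
    have h2 : HasDerivAt (fun z => (if j = 0 then γ 1 0 * (z / l) else
        if j = 1 then (2 * Real.pi * Complex.I)⁻¹ * (γ 1 0 / l) else 0))
        (if j = 0 then γ 1 0 * (1 / l) else 0) z := by
      split_ifs
      · exact ((hasDerivAt_id z).div_const l).const_mul _
      · exact hasDerivAt_const _ _
      · exact hasDerivAt_const _ _
    have h3 := (hasDerivAt_zetaDeriv j hz).sub h2
    have h4 : (fun z => l⁻¹ ^ (j + 1) * zetaDeriv j (z / l) (γ • τ)) =ᶠ[𝓝 z]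
        ((fun z => zetaDeriv j z τ) - fun z => (if j = 0 then γ 1 0 * (z / l) else
        if j = 1 then (2 * Real.pi * Complex.I)⁻¹ * (γ 1 0 / l) else 0)) := by
      filter_upwards [(periods τ).isClosed_lattice.isOpen_compl.mem_nhds hz] with w hw
      exact ih w hw
    have h5 := h1.unique (h3.congr_of_eventuallyEq h4)
    rw [← mul_right_inj' hI]
    rw [mul_sub]
    have h6 : ∀ c : ℂ, (2 * Real.pi * Complex.I) * (if j + 1 = 0 then γ 1 0 * (z / l) else
        if j + 1 = 1 then (2 * Real.pi * Complex.I)⁻¹ * (γ 1 0 / l) else 0) =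
        (if j = 0 then γ 1 0 * (1 / l) else 0) := by
      intro c
      by_cases hj : j = 0
      · subst hj
        simp only [zero_add, if_true, one_ne_zero, if_false]
        rw [mul_inv_cancel_left₀ hI, mul_one_div]
      · simp [hj]
    rw [h6 0, ← h5]
    ring

end

/-! ### Eisenstein series from values at torsion points -/

/-- A family of holomorphic functions indexed by residues modulo `N`, permuted by `Γ₀(N)` in
weight `j + 1`, up to the quasimodular correction in weight `2`. -/
structure IsEisensteinFamily (j N : ℕ) (F : ZMod N → ℍ → ℂ) : Prop where
  holo : ∀ a, IsUnit a → MDifferentiable 𝓘(ℂ) 𝓘(ℂ) (F a)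
  smul : ∀ a, IsUnit a → ∀ γ ∈ CongruenceSubgroup.Gamma0 N, ∀ τ : ℍ,
    (autFactor γ τ)⁻¹ ^ (j + 1) * F a (γ • τ) = F (a * ((γ 1 1 : ℤ) : ZMod N)) τ -
      if j = 1 then (2 * Real.pi * Complex.I)⁻¹ * (γ 1 0 / autFactor γ τ) else 0
  bdd : ∀ a, IsUnit a → ∀ γ : SL(2, ℤ), UpperHalfPlane.IsBoundedAtImInfty
    fun τ => (autFactor γ τ)⁻¹ ^ (j + 1) * F a (γ • τ)

lemma mdifferentiable_comp_coe {f : ℂ → ℂ} (hf : DifferentiableOn ℂ f {τ | 0 < τ.im}) :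
    MDifferentiable 𝓘(ℂ) 𝓘(ℂ) (fun τ : ℍ => f τ) := by
  rw [UpperHalfPlane.mdifferentiable_iff]
  refine hf.congr fun z hz => ?_
  simp only [Function.comp]
  rw [UpperHalfPlane.ofComplex_apply_of_im_pos hz]

lemma mdifferentiable_lambert (j : ℕ) {z : ℂ} (hz : z.im = 0) :
    MDifferentiable 𝓘(ℂ) 𝓘(ℂ) (fun τ : ℍ => lambert j (qexp z) (qexp τ) +
        (-1) ^ (j + 1) * lambert j (qexp (-z)) (qexp τ)) := by
  have h1 : ‖qexp z‖ = 1 := by simp [norm_qexp, hz]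
  have h2 : ‖qexp (-z)‖ = 1 := by simp [norm_qexp, hz]
  exact mdifferentiable_comp_coe ((differentiableOn_lambert_qexp j h1).add
    ((differentiableOn_lambert_qexp j h2).const_mul _))

lemma norm_qexp_le {w : ℂ} {k : ℕ} (h : k ≤ w.im) : ‖qexp w‖ ≤ (1 / 2) ^ k := by
  have h1 : Real.exp (-1) ≤ 1 / 2 := by
    have := Real.exp_one_gt_d9
    rw [Real.exp_neg, inv_eq_one_div]
    gcongr
    linarith
  calc ‖qexp w‖ ≤ Real.exp (k * (-1)) := by
        rw [norm_qexp, Real.exp_le_exp]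
        have := Real.pi_gt_three
        have h0 : (0 : ℝ) ≤ k := k.cast_nonneg
        nlinarith
    _ = Real.exp (-1) ^ k := Real.exp_nat_mul _ _
    _ ≤ _ := by gcongr

lemma exists_norm_lambert_le (j : ℕ) : ∃ C, ∀ x q : ℂ,
    (∀ n : ℕ, ‖x * q ^ (n + 1)‖ ≤ (1 / 2) ^ (n + 1)) → ‖lambert j x q‖ ≤ C := by
  obtain ⟨C, hC0, hC⟩ := exists_norm_polylog_le j
  refine ⟨∑' n : ℕ, C * (1 / 2) ^ (n + 1), fun x q h => ?_⟩
  refine tsum_of_norm_bounded (Summable.hasSum ?_) fun n => ?_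
  · exact ((summable_nat_add_iff 1).2 (summable_geometric_of_lt_one (by norm_num)
      (by norm_num))).mul_left C
  · refine (hC _ ((h n).trans ?_)).trans (by gcongr; exact h n)
    exact pow_le_of_le_one (by norm_num) (by norm_num) n.succ_ne_zero

/-- With `y = Im τ / N ≥ 1`, the imaginary part of `±w + (n+1)τ` is at least `((n+1)N - r)y ≥ n +
1`, because `r ≤ N - 1`. The arguments therefore decay geometrically, uniformly in `τ`. -/
lemma exists_norm_lambert_torsion_le (j : ℕ) {N r : ℕ} (hr : r < N) (s : ℤ) :
    ∃ C, ∀ τ : ℍ, N ≤ τ.im → ‖lambert j (qexp ((r * τ + s) / N)) (qexp τ) +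
        (-1) ^ (j + 1) * lambert j (qexp (-((r * τ + s) / N))) (qexp τ)‖ ≤ C := by
  obtain ⟨C, hC⟩ := exists_norm_lambert_le j
  have hN : (0 : ℝ) < N := by exact_mod_cast (Nat.zero_le r).trans_lt hr
  have hr' : (r : ℝ) + 1 ≤ N := by exact_mod_cast hr
  refine ⟨C + C, fun τ hτ => (norm_add_le _ _).trans ?_⟩
  have him : ((r * τ + s : ℂ) / N).im = r * τ.im / N := by
    rw [Complex.div_natCast_im]; simp
  have key : ∀ n : ℕ, ∀ w : ℂ, -(r * τ.im / N) ≤ w.im →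
      ‖qexp w * qexp τ ^ (n + 1)‖ ≤ (1 / 2) ^ (n + 1) := by
    intro n w hw
    rw [← qexp_nat_mul, ← qexp_add]
    apply norm_qexp_le
    have h1 : (w + ((n + 1 : ℕ) : ℂ) * τ).im = w.im + (n + 1) * τ.im := by simp
    rw [h1]
    push_cast
    have h2 : (1 : ℝ) ≤ τ.im / N := by rwa [le_div_iff₀ hN, one_mul]
    have h3 : r * τ.im / N = r * (τ.im / N) := by ring
    have h4 : τ.im = N * (τ.im / N) := by field_simp
    rw [h3] at hw
    rw [h4]
    set y := τ.im / N
    have hn : (0 : ℝ) ≤ n := n.cast_nonneg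
    have hr0 : (0 : ℝ) ≤ r := r.cast_nonneg
    nlinarith [mul_nonneg hn (mul_nonneg hr0 (sub_nonneg.2 h2)), mul_nonneg hn hr0,
      mul_nonneg hn (sub_nonneg.2 h2), mul_le_mul_of_nonneg_right hr' (zero_le_one.trans h2),
      mul_nonneg hn (mul_nonneg (sub_nonneg.2 hr') (zero_le_one.trans h2))]
  have h0 : 0 ≤ r * τ.im / N := by have := τ.im_pos; positivity
  have h1 := hC _ _ fun n => key n _ (by rw [him]; linarith)
  have h2 := hC (qexp (-((r * τ + s) / N))) (qexp τ) fun n => key n _ (by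
    rw [Complex.neg_im, him])
  rw [norm_mul, norm_pow, norm_neg, norm_one, one_pow, one_mul]
  exact add_le_add h1 h2

/-- Only the cotangent term is new: for `r = 0` it does not depend on `τ`, and for `r > 0` its
exponential has norm at most `1/2`. -/
lemma exists_norm_zetaDeriv_le (j : ℕ) {N r : ℕ} (hr : r < N) (s : ℤ) :
    ∃ C, ∀ τ : ℍ, N ≤ τ.im → ‖zetaDeriv j ((r * τ + s) / N) τ‖ ≤ C := by
  obtain ⟨C, hC⟩ := exists_norm_lambert_torsion_le j hr s
  have hN : (0 : ℝ) < N := by exact_mod_cast (Nat.zero_le r).trans_lt hr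
  obtain ⟨C', hC'⟩ : ∃ C', ∀ τ : ℍ, N ≤ τ.im → ‖cotDeriv j ((r * τ + s) / N)‖ ≤ C' := by
    rcases Nat.eq_zero_or_pos r with rfl | h
    · exact ⟨‖cotDeriv j (s / N)‖, fun τ _ => by simp⟩
    · obtain ⟨K, hK0, hK⟩ := exists_norm_polylog_le j
      refine ⟨K * 1 + ‖(polylogPoly j).eval 1‖, fun τ hτ => ?_⟩
      rw [cotDeriv_eq]
      refine (norm_add_le _ _).trans (add_le_add_left ?_ _)
      have h1 : ‖qexp ((r * τ + s) / N)‖ ≤ 1 / 2 := by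
        have := norm_qexp_le (w := (r * τ + s) / N) (k := 1) (by
          rw [Complex.div_natCast_im, le_div_iff₀ hN]
          have h2 : (1 : ℝ) ≤ r := by exact_mod_cast h
          have h3 := τ.im_pos
          simp
          nlinarith)
        simpa using this
      refine (hK _ h1).trans ?_
      gcongr
      linarith
  refine ⟨C' + C, fun τ hτ => (norm_add_le _ _).trans (add_le_add (hC' τ hτ) (hC τ hτ))⟩

lemma norm_div_autFactor_le (γ : SL(2, ℤ)) {τ : ℍ} (hτ : 1 ≤ τ.im) :
    ‖(γ 1 0 : ℂ) / autFactor γ τ‖ ≤ 1 := by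
  rw [norm_div]
  refine div_le_one_of_le₀ ?_ (norm_nonneg _)
  have h1 : (autFactor γ τ).im = γ 1 0 * τ.im := by simp [autFactor]
  calc ‖(γ 1 0 : ℂ)‖ = |(γ 1 0 : ℝ)| * 1 := by rw [Complex.norm_intCast, mul_one]
    _ ≤ |(γ 1 0 : ℝ)| * |τ.im| := by gcongr; exact hτ.trans (le_abs_self _)
    _ = |(autFactor γ τ).im| := by rw [h1, abs_mul]
    _ ≤ _ := Complex.abs_im_le_norm _

/-- Membership would force `N ∣ ac` and `N ∣ ad`; as `ad' - bc = 1` for the matrix, with lower row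
coprime, this gives `N ∣ a`, contradicting coprimality for `N ≥ 2`. -/
lemma torsion_notMem {N : ℕ} (hN : 2 ≤ N) {a : ℤ} (ha : IsCoprime a N) (γ : SL(2, ℤ)) (τ : ℍ) :
    (a : ℂ) / N * autFactor γ τ ∉ (periods τ).lattice := by
  intro h
  obtain ⟨m, n, h⟩ := mem_lattice_periods.1 h
  have hN0 : (N : ℂ) ≠ 0 := by simp; omega
  have h1 : ((N * m - a * γ 1 1 : ℤ) : ℂ) + ((N * n - a * γ 1 0 : ℤ) : ℂ) * τ = 0 := by
    rw [autFactor] at h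
    field_simp at h
    push_cast
    linear_combination h
  have h2 : N * n - a * γ 1 0 = 0 := by
    have := congrArg Complex.im h1
    simp only [Complex.add_im, Complex.intCast_im, Complex.mul_im, Complex.intCast_re, zero_mul,
      add_zero, zero_add, Complex.zero_im, UpperHalfPlane.coe_im, mul_eq_zero] at this
    rcases this with h | h
    · exact_mod_cast h
    · exact absurd h τ.im_ne_zero
  have h3 : N * m - a * γ 1 1 = 0 := by
    rw [h2] at h1
    simpa [-Int.cast_sub, -Int.cast_mul, -Int.cast_natCast] using! h1
  have hdet : γ 0 0 * γ 1 1 - γ 0 1 * γ 1 0 = 1 := by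
    have := γ.det_coe
    rwa [Matrix.det_fin_two] at this
  have h4 : (N : ℤ) ∣ a := ⟨m * γ 0 0 - n * γ 0 1, by
    linear_combination (-a) * hdet - γ 0 0 * h3 + γ 0 1 * h2⟩
  have h5 : IsUnit (N : ℤ) := ha.isUnit_of_dvd' h4 dvd_rfl
  rw [Int.isUnit_iff] at h5
  omega

lemma zetaDeriv_congr (j : ℕ) {z w : ℂ} (h : qexp z = qexp w) (τ : ℍ) :
    zetaDeriv j z τ = zetaDeriv j w τ := by
  simp [zetaDeriv, cotDeriv, qexp_neg, h]

lemma qexp_div_congr {N : ℕ} (hN : N ≠ 0) {a b : ℤ} (h : (a : ZMod N) = b) :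
    qexp (a / N) = qexp (b / N) := by
  obtain ⟨m, hm⟩ := (ZMod.intCast_eq_intCast_iff_dvd_sub a b N).1 h
  have hN0 : (N : ℂ) ≠ 0 := by simpa using hN
  have : (b : ℂ) / N = a / N + m := by
    rw [eq_add_of_sub_eq hm]
    push_cast
    field_simp
    ring
  rw [this, qexp_add, qexp_intCast, mul_one]

/-- The modular law is evaluated at `z = (a/N)(cτ + d)`, so that its left side sits at the fixed
torsion point `a/N`. If `N ∣ c`, then `z` differs from `ad/N` by a multiple of `τ`. For general `γ`,
`z` is a torsion point modulo the lattice, which gives growth control at every cusp. -/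
lemma isEisensteinFamily_zetaDeriv (j : ℕ) {N : ℕ} (hN : 2 ≤ N) :
    IsEisensteinFamily j N fun a τ => zetaDeriv j ((a.cast : ℤ) / N) τ := by
  have hN0 : (N : ℂ) ≠ 0 := by simp; omega
  have : NeZero N := ⟨by omega⟩
  have hcop : ∀ a : ZMod N, IsUnit a → IsCoprime (a.cast : ℤ) N := by
    intro a ha
    rw [isCoprime_comm, ← ZMod.coe_int_isUnit_iff_isCoprime]
    simpa using ha
  have hlaw : ∀ (γ : SL(2, ℤ)) (τ : ℍ) (a : ZMod N), IsUnit a →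
      (autFactor γ τ)⁻¹ ^ (j + 1) * zetaDeriv j ((a.cast : ℤ) / N) (γ • τ) =
        zetaDeriv j ((a.cast : ℤ) / N * autFactor γ τ) τ -
        (if j = 0 then γ 1 0 * (((a.cast : ℤ) : ℂ) / N) else
        if j = 1 then (2 * Real.pi * Complex.I)⁻¹ * (γ 1 0 / autFactor γ τ) else 0) := by
    intro γ τ a ha
    have h := zetaDeriv_smul (γ := γ) j _ (torsion_notMem hN (hcop a ha) γ τ)
    rwa [mul_div_cancel_right₀ _ (autFactor_ne_zero γ τ)] at h
  refine ⟨fun a ha => ?_, fun a ha γ hγ τ => ?_, fun a ha γ => ?_⟩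
  · refine mdifferentiable_const.add (mdifferentiable_lambert j ?_)
    rw [Complex.div_natCast_im, Complex.intCast_im, zero_div]
  · rw [hlaw γ τ a ha]
    obtain ⟨c, hc⟩ : (N : ℤ) ∣ γ 1 0 := by
      rwa [CongruenceSubgroup.Gamma0_mem, ZMod.intCast_zmod_eq_zero_iff_dvd] at hγ
    have h1 : ((a.cast : ℤ) : ℂ) / N * autFactor γ τ =
        ((a.cast * γ 1 1 : ℤ) : ℂ) / N + ((0 : ℤ) + ((a.cast * c : ℤ) : ℂ) * τ) := by
      rw [autFactor, hc]
      push_cast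
      field_simp
      ring
    have h2 : ((a.cast * γ 1 1 : ℤ) : ℂ) / N ∉ (periods τ).lattice := by
      intro h
      refine torsion_notMem hN (hcop a ha) γ τ ?_
      rw [h1]
      exact add_mem h (mem_lattice_periods.2 ⟨_, _, rfl⟩)
    rw [h1, zetaDeriv_add_period j h2]
    have h3 : qexp (((a.cast * γ 1 1 : ℤ) : ℂ) / N)
        = qexp ((((a * ((γ 1 1 : ℤ) : ZMod N)).cast : ℤ) : ℂ) / N) :=
      qexp_div_congr (NeZero.ne N) (by push_cast; simp)
    rw [zetaDeriv_congr j h3]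
    -- For `j = 0` the quasi-period `ac/N` cancels the anomaly `c·(a/N)`.
    by_cases hj : j = 0
    · subst hj
      simp only [if_true, zero_ne_one, if_false]
      rw [hc]
      push_cast
      field_simp
      ring
    · simp [hj]
  · have : (fun τ => (autFactor γ τ)⁻¹ ^ (j + 1) * zetaDeriv j ((a.cast : ℤ) / N) (γ • τ)) = _ :=
      funext fun τ => hlaw γ τ a ha
    rw [this]
    set A : ℤ := a.cast
    -- Dividing `ac` by `N` with remainder brings the `τ`-coordinate into `[0, 1)`, where the
    -- uniform bound applies.
    have hr0 : 0 ≤ A * γ 1 0 % N := Int.emod_nonneg _ (by omega)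
    obtain ⟨r, hr⟩ := Int.eq_ofNat_of_zero_le hr0
    have hrN : r < N := by
      have := Int.emod_lt_of_pos (A * γ 1 0) (show (0 : ℤ) < N by omega)
      omega
    set m := A * γ 1 0 / N
    have hdiv : A * γ 1 0 = N * m + r := by
      have := Int.mul_ediv_add_emod (A * γ 1 0) N
      rw [hr] at this
      exact this.symm
    have h1 : ∀ τ : ℍ, (A : ℂ) / N * autFactor γ τ =
        ((r : ℂ) * τ + ((A * γ 1 1 : ℤ) : ℂ)) / N + ((0 : ℤ) + (m : ℂ) * τ) := by
      intro τ
      have h2 : (A : ℂ) * γ 1 0 = N * m + r := by exact_mod_cast hdiv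
      rw [autFactor]
      push_cast
      field_simp
      linear_combination (τ : ℂ) * h2
    obtain ⟨C, hC⟩ := exists_norm_zetaDeriv_le j hrN (A * γ 1 1)
    rw [UpperHalfPlane.isBoundedAtImInfty_iff]
    refine ⟨C + ‖(m : ℂ)‖ + (‖(γ 1 0 : ℂ) * ((A : ℂ) / N)‖ + ‖(2 * Real.pi * Complex.I)⁻¹‖ * 1), N,
      fun τ hτ => ?_⟩
    have h2 : ((r : ℂ) * τ + ((A * γ 1 1 : ℤ) : ℂ)) / N ∉ (periods τ).lattice := by
      intro h
      refine torsion_notMem hN (hcop a ha) γ τ ?_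
      rw [h1]
      exact add_mem h (mem_lattice_periods.2 ⟨_, _, rfl⟩)
    have hτ1 : 1 ≤ τ.im := le_trans (by exact_mod_cast (by omega : 1 ≤ N)) hτ
    rw [h1, zetaDeriv_add_period j h2]
    refine (norm_sub_le _ _).trans (add_le_add ((norm_add_le _ _).trans
      (add_le_add (hC τ hτ) ?_)) ?_)
    · split_ifs <;> simp
    · split_ifs
      · linarith [norm_nonneg (2 * Real.pi * Complex.I)⁻¹]
      · rw [norm_mul]
        have := norm_div_autFactor_le γ hτ1
        have h3 := norm_nonneg ((γ 1 0 : ℂ) * ((A : ℂ) / N))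
        have h4 : ‖(2 * Real.pi * Complex.I)⁻¹‖ * ‖(γ 1 0 : ℂ) / autFactor γ τ‖ ≤
          ‖(2 * Real.pi * Complex.I)⁻¹‖ * 1 := by gcongr
        linarith
      · rw [norm_zero]; positivity

/-- The level one Eisenstein series as the regular part of `zetaDeriv j` at `0`. -/
lemma exists_isEisensteinFamily_one (j : ℕ) : ∃ c : ℂ, IsEisensteinFamily j 1
    fun _ τ => c + (lambert j (qexp 0) (qexp τ) + (-1) ^ (j + 1) * lambert j (qexp (-0)) (qexp τ)) := by
  obtain ⟨A, t, ht, hAt⟩ := exists_cotDeriv_eq_add j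
  refine ⟨t 0, ?_⟩
  set S : ℂ → ℍ → ℂ := fun z τ => lambert j (qexp z) (qexp τ) +
    (-1) ^ (j + 1) * lambert j (qexp (-z)) (qexp τ) with hS
  have hlaw : ∀ (γ : SL(2, ℤ)) (τ : ℍ), (autFactor γ τ)⁻¹ ^ (j + 1) * (t 0 + S 0 (γ • τ)) =
      (t 0 + S 0 τ) -
      (if j = 1 then (2 * Real.pi * Complex.I)⁻¹ * (γ 1 0 / autFactor γ τ) else 0) := by
    intro γ τ
    set l := autFactor γ τ with hl
    have h0 : l ≠ 0 := autFactor_ne_zero γ τ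
    have hScont : ∀ τ : ℍ, ContinuousAt (fun z => t z + S z τ) 0 := by
      intro τ
      have h2 : ∀ n : ℕ, qexp (0 : ℂ) * qexp τ ^ (n + 1) ≠ 1 := by
        intro n h
        have h3 := congrArg norm h
        rw [qexp_zero, one_mul, norm_pow, norm_one] at h3
        exact (pow_lt_one₀ (norm_nonneg _) (norm_qexp_coe_lt_one τ) (Nat.succ_ne_zero n)).ne h3
      exact ht.continuousAt.add (hasDerivAt_zetaDeriv_aux j h2 (by rwa [neg_zero])).continuousAt
    have hdiv : ContinuousAt (fun z : ℂ => z / l) 0 := (continuous_id.div_const l).continuousAt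
    have hLc : ContinuousAt (fun z => l⁻¹ ^ (j + 1) * (t (z / l) + S (z / l) (γ • τ))) 0 := by
      have h3 := hScont (γ • τ)
      rw [← zero_div l] at h3
      exact (ContinuousAt.comp (f := fun z : ℂ => z / l) h3 hdiv).const_mul _
    have hRc : ContinuousAt (fun z => (t z + S z τ) - (if j = 0 then γ 1 0 * (z / l) else
        if j = 1 then (2 * Real.pi * Complex.I)⁻¹ * (γ 1 0 / l) else 0)) 0 := by
      refine (hScont τ).sub ?_
      split_ifs
      · exact hdiv.const_mul _
      · exact continuousAt_const
      · exact continuousAt_const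
    have h2 : Tendsto (fun z : ℂ => z / l) (𝓝[≠] 0) (𝓝[≠] 0) := by
      refine tendsto_nhdsWithin_iff.2 ⟨?_, ?_⟩
      · have := hdiv.tendsto
        rw [zero_div] at this
        exact this.mono_left nhdsWithin_le_nhds
      · filter_upwards [self_mem_nhdsWithin] with z hz
        exact div_ne_zero hz h0
    have h1 : ∀ᶠ z in 𝓝[≠] (0 : ℂ), z ∉ (periods τ).lattice := by
      rw [eventually_nhdsWithin_iff]
      have h1 : ∀ᶠ z in 𝓝 (0 : ℂ), z ∈ (↑(periods τ).lattice \ {0} : Set ℂ)ᶜ :=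
        (periods τ).compl_lattice_sdiff_singleton_mem_nhds 0
      filter_upwards [h1] with z hz hz0 hz1
      exact hz ⟨hz1, hz0⟩
    have heq : (fun z => l⁻¹ ^ (j + 1) * (t (z / l) + S (z / l) (γ • τ))) =ᶠ[𝓝[≠] 0]
        fun z => (t z + S z τ) - (if j = 0 then γ 1 0 * (z / l) else
        if j = 1 then (2 * Real.pi * Complex.I)⁻¹ * (γ 1 0 / l) else 0) := by
      filter_upwards [hAt, h2.eventually hAt, h1] with z hz1 hz2 hz
      have h4 := zetaDeriv_smul (γ := γ) j z hz
      simp only [zetaDeriv] at h4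
      rw [← hl, hz1, hz2] at h4
      have h5 : l⁻¹ ^ (j + 1) * (A / (z / l) ^ (j + 1)) = A / z ^ (j + 1) := by
        rw [div_pow, inv_pow]
        field_simp
      simp only [hS]
      linear_combination h4 - h5
    -- After the principal parts cancel, both sides are continuous at `z = 0` and agree near it,
    -- hence at it.
    have := tendsto_nhds_unique (hLc.tendsto.mono_left nhdsWithin_le_nhds)
      ((hRc.tendsto.mono_left nhdsWithin_le_nhds).congr' heq.symm)
    simp only [zero_div, mul_zero] at this
    rw [this]
    by_cases hj : j = 0
    · simp [hj]
    · simp [hj]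
  refine ⟨fun _ _ => ?_, fun _ _ γ _ τ => hlaw γ τ, fun _ _ γ => ?_⟩
  · exact mdifferentiable_const.add (mdifferentiable_lambert j (by simp))
  · have h1 : (fun τ => (autFactor γ τ)⁻¹ ^ (j + 1) * (t 0 + S 0 (γ • τ))) = _ :=
      funext fun τ => hlaw γ τ
    rw [h1, UpperHalfPlane.isBoundedAtImInfty_iff]
    obtain ⟨C, hC⟩ := exists_norm_lambert_torsion_le j Nat.zero_lt_one 0
    refine ⟨‖t 0‖ + C + ‖(2 * Real.pi * Complex.I)⁻¹‖ * 1, 1, fun τ hτ => ?_⟩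
    refine (norm_sub_le _ _).trans (add_le_add ((norm_add_le _ _).trans
      (add_le_add le_rfl ?_)) ?_)
    · have := hC τ (by simpa using hτ)
      simpa [hS] using this
    · split_ifs
      · rw [norm_mul]
        gcongr
        exact norm_div_autFactor_le γ hτ
      · rw [norm_zero]; positivity

/-! ### From Eisenstein families to quasimodular forms with character -/

lemma mdifferentiable_finset_sum {ι : Type*} (s : Finset ι) {f : ι → ℍ → ℂ}
    (hf : ∀ i ∈ s, MDifferentiable 𝓘(ℂ) 𝓘(ℂ) (f i)) :
    MDifferentiable 𝓘(ℂ) 𝓘(ℂ) (fun τ => ∑ i ∈ s, f i τ) := by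
  classical
  induction s using Finset.induction_on with
  | empty => simpa using mdifferentiable_const
  | insert i s hi ih =>
    simp only [Finset.sum_insert hi]
    exact (hf i (Finset.mem_insert_self _ _)).add
      (ih fun j hj => hf j (Finset.mem_insert_of_mem hj))

lemma isUnit_of_mem_Gamma0 {N : ℕ} {γ : SL(2, ℤ)} (hγ : γ ∈ CongruenceSubgroup.Gamma0 N) :
    IsUnit ((γ 1 1 : ℤ) : ZMod N) := by
  rw [CongruenceSubgroup.Gamma0_mem] at hγ
  have hdet : γ 0 0 * γ 1 1 - γ 0 1 * γ 1 0 = 1 := by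
    have := γ.det_coe
    rwa [Matrix.det_fin_two] at this
  have h := congrArg (Int.cast : ℤ → ZMod N) hdet
  push_cast at h
  rw [hγ, mul_zero, sub_zero, mul_comm] at h
  exact IsUnit.of_mul_eq_one _ h

lemma slash_eq_autFactor (k : ℕ) (f : ℍ → ℂ) (γ : SL(2, ℤ)) :
    f ∣[(k : ℤ)] γ = fun τ => (autFactor γ τ)⁻¹ ^ k * f (γ • τ) := by
  funext τ
  rw [ModularForm.SL_slash_apply, mul_comm, zpow_neg, zpow_natCast, inv_pow]
  rfl

section

variable {j N : ℕ} {F : ZMod N → ℍ → ℂ}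

/-- The substitution `b ↦ bd` in the character sum produces the factor `χ⁻¹(d)`. The weight-two
anomaly does not depend on `b` and becomes the coefficient of `c/(cτ + d)`. -/
lemma IsEisensteinFamily.isQuasimodular_sum [NeZero N] (hF : IsEisensteinFamily j N F)
    (χ : DirichletCharacter ℂ N) :
    IsQuasimodular ((j + 1 : ℕ) : ℤ) χ⁻¹ (fun τ => ∑ b, χ b * F b τ) := by
  set κ : ℂ := if j = 1 then (2 * Real.pi * Complex.I)⁻¹ else 0 with hκ
  have hholo : MDifferentiable 𝓘(ℂ) 𝓘(ℂ) (fun τ => ∑ b, χ b * F b τ) := by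
    refine mdifferentiable_finset_sum _ fun b _ => ?_
    by_cases hb : IsUnit b
    · exact mdifferentiable_const.mul (hF.holo b hb)
    · simp only [χ.map_nonunit hb, zero_mul]
      exact mdifferentiable_const
  refine ⟨hholo, ⟨1, fun i τ => if i = 0 then ∑ b, χ b * F b τ else -κ * ∑ b, χ b, ?_, ?_⟩, ?_⟩
  · intro i _
    by_cases hi : i = 0
    · simpa [hi] using hholo
    · simpa [hi] using mdifferentiable_const
  · intro γ hγ τ
    have hd := isUnit_of_mem_Gamma0 hγ
    have hl := autFactor_ne_zero γ τ
    change _ = _ * autFactor γ τ ^ ((j + 1 : ℕ) : ℤ) * _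
    change _ = _ * _ * ∑ i ∈ _, _ * (_ / autFactor γ τ) ^ i
    set d : ZMod N := ((γ 1 1 : ℤ) : ZMod N)
    have h1 : ∀ b, χ b * F b (γ • τ) = χ⁻¹ d * autFactor γ τ ^ (j + 1) *
        (χ (b * d) * (F (b * d) τ - κ * (γ 1 0 / autFactor γ τ))) := by
      intro b
      by_cases hb : IsUnit b
      · have h2 := hF.smul b hb γ hγ τ
        have h3 : χ⁻¹ d * χ d = 1 := by
          rw [← MulChar.mul_apply, inv_mul_cancel, MulChar.one_apply hd]
        have h4 : F b (γ • τ) = autFactor γ τ ^ (j + 1) *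
            (F (b * d) τ - κ * (γ 1 0 / autFactor γ τ)) := by
          rw [← mul_inv_cancel_left₀ (pow_ne_zero (j + 1) hl) (F b (γ • τ)), ← inv_pow, h2, hκ,
            ite_mul, zero_mul]
        rw [h4, map_mul]
        linear_combination (-χ b * (autFactor γ τ ^ (j + 1) *
            (F (b * d) τ - κ * (γ 1 0 / autFactor γ τ)))) * h3
      · rw [map_mul, χ.map_nonunit hb]
        simp
    simp only [h1]
    rw [← Finset.mul_sum]
    have h5 : ∑ b, χ (b * d) * (F (b * d) τ - κ * (γ 1 0 / autFactor γ τ)) =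
        ∑ b, χ b * (F b τ - κ * (γ 1 0 / autFactor γ τ)) :=
      Fintype.sum_bijective (fun b => b * d) (hd.unit.mulRight_bijective) _ _ fun _ => rfl
    rw [h5, zpow_natCast]
    congr 1
    simp only [mul_sub, Finset.sum_sub_distrib, ← Finset.sum_mul, Finset.sum_range_succ,
      Finset.sum_range_zero, if_true, one_ne_zero, if_false]
    ring
  · intro γ
    rw [slash_eq_autFactor]
    have h1 : (fun τ => (autFactor γ τ)⁻¹ ^ (j + 1) * ∑ b, χ b * F b (γ • τ)) =
        ∑ b, χ b • (fun τ => (autFactor γ τ)⁻¹ ^ (j + 1) * F b (γ • τ)) := by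
      funext τ
      simp only [Finset.sum_apply, Pi.smul_apply, smul_eq_mul, Finset.mul_sum]
      exact Finset.sum_congr rfl fun b _ => by ring
    rw [h1]
    refine (UpperHalfPlane.boundedAtImInftySubalgebra ℂ).sum_mem fun b _ => ?_
    by_cases hb : IsUnit b
    · exact Subalgebra.smul_mem _ (hF.bdd b hb γ) _
    · rw [χ.map_nonunit hb, zero_smul]
      exact zero_mem _

/-- Orthogonality of Dirichlet characters modulo `N` inverts the character sums and isolates a
single unit residue. -/
lemma IsEisensteinFamily.isMixedQuasimodular [NeZero N] (hF : IsEisensteinFamily j N F)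
    {k : ℕ} (hjk : j < k) {a : ZMod N} (ha : IsUnit a) : IsMixedQuasimodular k N (F a) := by
  have hφ : (N.totient : ℂ) ≠ 0 := by
    simp [NeZero.ne N]
  have h1 : F a = ∑ χ : DirichletCharacter ℂ N,
      ((N.totient : ℂ)⁻¹ * χ a⁻¹) • fun τ => ∑ b, χ b * F b τ := by
    funext τ
    simp only [Finset.sum_apply, Pi.smul_apply, smul_eq_mul, Finset.mul_sum]
    rw [Finset.sum_comm]
    have h2 : ∀ b, ∑ χ : DirichletCharacter ℂ N, (N.totient : ℂ)⁻¹ * χ a⁻¹ * (χ b * F b τ) =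
        (N.totient : ℂ)⁻¹ * (if a = b then (N.totient : ℂ) else 0) * F b τ := by
      intro b
      rw [← DirichletCharacter.sum_char_inv_mul_char_eq ℂ ha b, Finset.mul_sum, Finset.sum_mul]
      exact Finset.sum_congr rfl fun χ _ => by ring
    simp only [h2, mul_ite, mul_zero, ite_mul, zero_mul, Finset.sum_ite_eq, Finset.mem_univ,
      if_true]
    rw [inv_mul_cancel₀ hφ, one_mul]
  rw [h1]
  exact Submodule.sum_mem _ fun χ _ => Submodule.smul_mem _ _ (Submodule.subset_span
    ⟨j + 1, hjk, N, dvd_rfl, χ⁻¹, hF.isQuasimodular_sum χ⟩)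

end

/-! ### Products of quasimodular forms -/

lemma isQuasimodular_const (N : ℕ) (c : ℂ) :
    IsQuasimodular (0 : ℕ) (1 : DirichletCharacter ℂ N) (fun _ => c) := by
  refine ⟨mdifferentiable_const, ⟨0, fun _ _ => c, fun _ _ => mdifferentiable_const, ?_⟩, ?_⟩
  · intro γ hγ τ
    simp [MulChar.one_apply (isUnit_of_mem_Gamma0 hγ)]
  · intro γ
    rw [slash_eq_autFactor]
    simpa using! Filter.const_boundedAtFilter _ c

lemma isMixedQuasimodular_const (k N : ℕ) (c : ℂ) : IsMixedQuasimodular k N (fun _ => c) :=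
  Submodule.subset_span ⟨0, k.zero_le, N, dvd_rfl, 1, isQuasimodular_const N c⟩

/-- Factors of different levels dividing `N` are brought to level `N` before being multiplied. -/
lemma IsQuasimodular.changeLevel {k : ℤ} {M N : ℕ} {χ : DirichletCharacter ℂ M} {f : ℍ → ℂ}
    (hf : IsQuasimodular k χ f) (hMN : M ∣ N) :
    IsQuasimodular k (DirichletCharacter.changeLevel hMN χ) f := by
  obtain ⟨h1, ⟨s, F, hF, hs⟩, h2⟩ := hf
  refine ⟨h1, ⟨s, F, hF, fun γ hγ τ => ?_⟩, h2⟩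
  have hu := isUnit_of_mem_Gamma0 hγ
  have hγ' : γ ∈ CongruenceSubgroup.Gamma0 M := by
    rw [CongruenceSubgroup.Gamma0_mem, ZMod.intCast_zmod_eq_zero_iff_dvd] at hγ ⊢
    exact (Int.natCast_dvd_natCast.2 hMN).trans hγ
  rw [hs γ hγ' τ]
  congr 2
  obtain ⟨u, hu⟩ := hu
  rw [← hu, DirichletCharacter.changeLevel_eq_cast_of_dvd, hu, ZMod.cast_intCast hMN]

lemma IsQuasimodular.mul {k l : ℤ} {N : ℕ} {χ ψ : DirichletCharacter ℂ N} {f g : ℍ → ℂ}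
    (hf : IsQuasimodular k χ f) (hg : IsQuasimodular l ψ g) :
    IsQuasimodular (k + l) (χ * ψ) (f * g) := by
  obtain ⟨hf1, ⟨s, F, hF, hs⟩, hf2⟩ := hf
  obtain ⟨hg1, ⟨r, G, hG, hr⟩, hg2⟩ := hg
  -- The Cauchy product of the two polynomials in `c/(cτ + d)`, so the depths add.
  refine ⟨hf1.mul hg1, ⟨s + r, fun n τ => ∑ p ∈ (Finset.range (s + 1) ×ˢ Finset.range (r + 1)) with
    p.1 + p.2 = n, F p.1 τ * G p.2 τ, ?_, ?_⟩, ?_⟩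
  · intro n _
    refine mdifferentiable_finset_sum _ fun p hp => ?_
    simp only [Finset.mem_filter, Finset.mem_product, Finset.mem_range] at hp
    exact (hF _ (by omega)).mul (hG _ (by omega))
  · intro γ hγ τ
    have hl := autFactor_ne_zero γ τ
    change (γ 1 0 : ℂ) * τ + (γ 1 1 : ℂ) ≠ 0 at hl
    rw [Pi.mul_apply, hs γ hγ τ, hr γ hγ τ, MulChar.mul_apply, zpow_add₀ hl]
    set y := (γ 1 0 : ℂ) / ((γ 1 0 : ℂ) * τ + (γ 1 1 : ℂ))
    have h1 : (∑ i ∈ Finset.range (s + 1), F i τ * y ^ i) *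
        ∑ i ∈ Finset.range (r + 1), G i τ * y ^ i =
        ∑ n ∈ Finset.range (s + r + 1), (∑ p ∈ (Finset.range (s + 1) ×ˢ Finset.range (r + 1)) with
          p.1 + p.2 = n, F p.1 τ * G p.2 τ) * y ^ n := by
      rw [Finset.sum_mul_sum, ← Finset.sum_product',
        ← Finset.sum_fiberwise_of_maps_to (t := Finset.range (s + r + 1))
          (g := fun p : ℕ × ℕ => p.1 + p.2)]
      · refine Finset.sum_congr rfl fun n _ => ?_
        rw [Finset.sum_mul]
        refine Finset.sum_congr rfl fun p hp => ?_
        rw [← (Finset.mem_filter.1 hp).2, pow_add]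
        ring
      · intro p hp
        simp only [Finset.mem_product, Finset.mem_range] at hp ⊢
        omega
    rw [← h1]
    ring
  · intro γ
    rw [ModularForm.mul_slash_SL2]
    exact (UpperHalfPlane.boundedAtImInftySubalgebra ℂ).mul_mem (hf2 γ) (hg2 γ)

lemma IsMixedQuasimodular.mul {k l N : ℕ} {f g : ℍ → ℂ} (hf : IsMixedQuasimodular k N f)
    (hg : IsMixedQuasimodular l N g) : IsMixedQuasimodular (k + l) N (f * g) := by
  have h := Submodule.mul_mem_mul hf hg
  rw [Submodule.span_mul_span] at h
  refine Submodule.span_mono ?_ h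
  rintro _ ⟨f, ⟨w, hw, M, hM, χ, hf⟩, g, ⟨w', hw', M', hM', χ', hg⟩, rfl⟩
  have := (hf.changeLevel hM).mul (hg.changeLevel hM')
  rw [← Nat.cast_add] at this
  exact ⟨w + w', by omega, N, dvd_rfl, _, this⟩

lemma IsMixedQuasimodular.pow {k N : ℕ} {f : ℍ → ℂ} (hf : IsMixedQuasimodular k N f) (n : ℕ) :
    IsMixedQuasimodular (n * k) N (f ^ n) := by
  induction n with
  | zero => exact isMixedQuasimodular_const _ _ 1
  | succ n ih =>
    rw [pow_succ, add_mul, one_mul]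
    exact ih.mul hf

lemma isMixedQuasimodular_prod {ι : Type*} (s : Finset ι) {N : ℕ} {k : ι → ℕ} {f : ι → ℍ → ℂ}
    (hf : ∀ i ∈ s, IsMixedQuasimodular (k i) N (f i)) :
    IsMixedQuasimodular (∑ i ∈ s, k i) N (∏ i ∈ s, f i) := by
  classical
  induction s using Finset.induction_on with
  | empty => exact isMixedQuasimodular_const _ _ 1
  | insert i s hi ih =>
    rw [Finset.sum_insert hi, Finset.prod_insert hi]
    exact (hf i (Finset.mem_insert_self _ _)).mul
      (ih fun j hj => hf j (Finset.mem_insert_of_mem hj))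

/-! ### Partial fractions -/

/-- The polynomials `1, polylogPoly 0, polylogPoly 1, …`, one in each degree. -/
def polylogBasis : ℕ → ℂ[X]
  | 0 => 1
  | j + 1 => polylogPoly j

lemma X_pow_mem_span_polylogBasis (m : ℕ) : (Polynomial.X ^ m : ℂ[X]) ∈
    Submodule.span ℂ (polylogBasis '' (Finset.range (m + 1) : Set ℕ)) := by
  set B : ℕ → ℂ[X] := polylogBasis with hBdef
  have hmono : ∀ {a b : ℕ}, a ≤ b → Submodule.span ℂ (B '' (Finset.range a : Set ℕ)) ≤
      Submodule.span ℂ (B '' (Finset.range b : Set ℕ)) := fun h =>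
    Submodule.span_mono (Set.image_mono (by simpa using h))
  have hB : ∀ {a b : ℕ}, a < b → B a ∈ Submodule.span ℂ (B '' (Finset.range b : Set ℕ)) :=
    fun h => Submodule.subset_span ⟨_, by simpa using h, rfl⟩
  induction m with
  | zero => exact hB zero_lt_one
  | succ m ih =>
    rcases Nat.eq_zero_or_pos m with rfl | hm
    · have : (Polynomial.X ^ (0 + 1) : ℂ[X]) = B 1 + (1 / 2 : ℂ) • B 0 := by
        simp only [B, polylogBasis, polylogPoly, Polynomial.smul_eq_C_mul]
        ring
      rw [this]
      exact add_mem (hB one_lt_two) (Submodule.smul_mem _ _ (hB zero_lt_two))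
    · set θ : ℂ[X] →ₗ[ℂ] ℂ[X] :=
        (LinearMap.mulRight ℂ (Polynomial.X ^ 2 - Polynomial.X)).comp Polynomial.derivative
        with hθ
      have h1 : Submodule.map θ (Submodule.span ℂ (B '' (Finset.range (m + 1) : Set ℕ))) ≤
          Submodule.span ℂ (B '' (Finset.range (m + 1 + 1) : Set ℕ)) := by
        rw [Submodule.map_span_le]
        rintro _ ⟨i, hi, rfl⟩
        rcases i with _ | i
        · have : θ (B 0) = 0 := by simp [hθ, B, polylogBasis]
          rw [this]
          exact zero_mem _
        · have : θ (B (i + 1)) = B (i + 2) := by simp [hθ, B, polylogBasis, polylogPoly]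
          rw [this]
          simp only [Finset.coe_range, Set.mem_Iio] at hi
          exact hB (by omega)
      -- The operator `θ = (X^2 - X) d/dX` sends `X^m` to `m(X^(m+1) - X^m)` and moves each
      -- non-constant basis element to the next; dividing by `m` is why the first power is treated
      -- apart.
      have h2 : (Polynomial.X ^ (m + 1) : ℂ[X])
          = Polynomial.X ^ m + (m : ℂ)⁻¹ • θ (Polynomial.X ^ m) := by
        have hm0 : (m : ℂ) ≠ 0 := by simp; omega
        obtain ⟨n, rfl⟩ : ∃ n, m = n + 1 := ⟨m - 1, by omega⟩
        have h3 : (Polynomial.C ((n + 1 : ℕ) : ℂ)⁻¹ : ℂ[X]) * Polynomial.C ((n + 1 : ℕ) : ℂ) = 1 := by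
          rw [← Polynomial.C_mul, inv_mul_cancel₀ hm0, Polynomial.C_1]
        simp only [hθ, LinearMap.comp_apply, Polynomial.derivative_X_pow, LinearMap.mulRight_apply,
          Polynomial.smul_eq_C_mul, Nat.add_sub_cancel]
        linear_combination (-(Polynomial.X ^ (n + 2) - Polynomial.X ^ (n + 1))) * h3
      rw [h2]
      exact add_mem (hmono (by omega) ih) (Submodule.smul_mem _ _ (h1 ⟨_, ih, rfl⟩))

lemma exists_pow_eq_sum_polylogPoly {m k : ℕ} (h : m ≤ k) : ∃ (e₀ : ℂ) (e : ℕ → ℂ), ∀ u : ℂ,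
    u ^ m = e₀ + ∑ j ∈ Finset.range k, e j * (polylogPoly j).eval u := by
  have h1 := Submodule.span_mono (R := ℂ) (Set.image_mono (f := polylogBasis) (by simpa using h :
      (Finset.range (m + 1) : Set ℕ) ⊆ (Finset.range (k + 1) : Set ℕ)))
    (X_pow_mem_span_polylogBasis m)
  rw [Submodule.mem_span_image_finset_iff_exists_fun'] at h1
  obtain ⟨c, hc⟩ := h1
  refine ⟨c 0, fun j => c (j + 1), fun u => ?_⟩
  have h2 := congrArg (Polynomial.eval u) hc
  rw [Finset.sum_range_succ'] at h2
  simp only [Polynomial.eval_add, Polynomial.eval_finsetSum, Polynomial.eval_smul, smul_eq_mul,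
    polylogBasis, Polynomial.eval_one, mul_one, Polynomial.eval_pow, Polynomial.eval_X] at h2
  rw [← h2, add_comm]

/-- Partial fractions: remainders modulo linear factors are constants, and the degree bound removes
the polynomial part. -/
lemma exists_div_prod_pow_eq (s : Finset ℂ) (k : ℕ) (Q : ℂ[X]) (hQ : Q.natDegree < s.card * k) :
    ∃ c : ℂ → Fin k → ℂ, ∀ x ∉ s,
      Q.eval x / (∏ r ∈ s, (x - r)) ^ k = ∑ r ∈ s, ∑ i, c r i * (1 / (x - r)) ^ (k - i.1) := by
  obtain ⟨q, r, hr, hQr⟩ := Polynomial.eq_quo_mul_prod_pow_add_sum_rem_mul_prod_pow (s := s) Q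
    (g := fun r => Polynomial.X - Polynomial.C r) (fun r _ => Polynomial.monic_X_sub_C r)
    (fun a _ b _ hab => Polynomial.isCoprime_X_sub_C_of_isUnit_sub (sub_ne_zero.2 hab).isUnit)
    (fun _ => k)
  have hk : k ≠ 0 := by rintro rfl; simp at hQ
  have hconst : ∀ a ∈ s, ∀ i, r a i = Polynomial.C ((r a i).coeff 0) := by
    intro a ha i
    refine Polynomial.eq_C_of_degree_le_zero ?_
    have := hr a ha i
    rw [Polynomial.degree_X_sub_C] at this
    exact (Nat.WithBot.lt_one_iff_le_zero).1 this
  have hMmonic : (∏ a ∈ s, (Polynomial.X - Polynomial.C a) ^ k).Monic :=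
    Polynomial.monic_prod_of_monic _ _ fun a _ => (Polynomial.monic_X_sub_C a).pow k
  have hMdeg : (∏ a ∈ s, (Polynomial.X - Polynomial.C a) ^ k).degree = ((s.card * k : ℕ) : WithBot ℕ) := by
    rw [Polynomial.degree_eq_natDegree hMmonic.ne_zero, Polynomial.natDegree_prod_of_monic _ _
      fun a _ => (Polynomial.monic_X_sub_C a).pow k]
    simp [Polynomial.natDegree_pow]
  have hq : q = 0 := by
    by_contra hq0
    have h1 : q * ∏ a ∈ s, (Polynomial.X - Polynomial.C a) ^ k = Q - ∑ a ∈ s, ∑ i, r a i *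
        (Polynomial.X - Polynomial.C a) ^ i.1 * ∏ b ∈ s.erase a,
          (Polynomial.X - Polynomial.C b) ^ k := eq_sub_of_add_eq hQr.symm
    have h2 : (∑ a ∈ s, ∑ i, r a i * (Polynomial.X - Polynomial.C a) ^ i.1 * ∏ b ∈ s.erase a,
          (Polynomial.X - Polynomial.C b) ^ k).degree < ((s.card * k : ℕ) : WithBot ℕ) := by
      rw [← Polynomial.mem_degreeLT]
      refine Submodule.sum_mem _ fun a ha => Submodule.sum_mem _ fun i _ => ?_
      rw [hconst a ha i, mul_assoc, ← Polynomial.smul_eq_C_mul]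
      refine Submodule.smul_mem _ _ ?_
      rw [Polynomial.mem_degreeLT]
      have hm : ((Polynomial.X - Polynomial.C a) ^ i.1 * ∏ b ∈ s.erase a,
          (Polynomial.X - Polynomial.C b) ^ k).Monic := ((Polynomial.monic_X_sub_C a).pow _).mul
        (Polynomial.monic_prod_of_monic _ _ fun a _ => (Polynomial.monic_X_sub_C a).pow k)
      rw [Polynomial.degree_eq_natDegree hm.ne_zero, Polynomial.Monic.natDegree_mul
        ((Polynomial.monic_X_sub_C a).pow _)
        (Polynomial.monic_prod_of_monic _ _ fun a _ => (Polynomial.monic_X_sub_C a).pow k),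
        Polynomial.natDegree_prod_of_monic _ _ fun a _ => (Polynomial.monic_X_sub_C a).pow k]
      simp only [Polynomial.natDegree_pow, Polynomial.natDegree_X_sub_C, mul_one, Finset.sum_const,
        smul_eq_mul, Finset.card_erase_of_mem ha]
      have h3 : 0 < s.card := Finset.card_pos.2 ⟨a, ha⟩
      have h4 := i.2
      norm_cast
      obtain ⟨n, hn⟩ : ∃ n, s.card = n + 1 := ⟨s.card - 1, by omega⟩
      rw [hn]
      simp only [Nat.add_sub_cancel]
      nlinarith
    have h3 : (q * ∏ a ∈ s, (Polynomial.X - Polynomial.C a) ^ k).degree < ((s.card * k : ℕ) : WithBot ℕ) := by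
      rw [h1]
      refine (Polynomial.degree_sub_le _ _).trans_lt (max_lt ?_ h2)
      exact Polynomial.degree_le_natDegree.trans_lt (by exact_mod_cast hQ)
    rw [Polynomial.degree_mul, hMdeg, Polynomial.degree_eq_natDegree hq0] at h3
    norm_cast at h3
    omega
  refine ⟨fun a i => (r a i).coeff 0, fun x hx => ?_⟩
  have hne : ∀ a ∈ s, x - a ≠ 0 := fun a ha h => hx (by rwa [sub_eq_zero.1 h])
  have hP : ∀ t ⊆ s, ∏ a ∈ t, (x - a) ^ k ≠ 0 := fun t ht =>
    Finset.prod_ne_zero_iff.2 fun a ha => pow_ne_zero _ (hne a (ht ha))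
  have h1 := congrArg (Polynomial.eval x) hQr
  simp only [hq, zero_mul, zero_add, Polynomial.eval_finsetSum, Polynomial.eval_mul,
    Polynomial.eval_pow, Polynomial.eval_sub, Polynomial.eval_X, Polynomial.eval_C,
    Polynomial.eval_prod] at h1
  rw [h1, ← Finset.prod_pow, Finset.sum_div]
  refine Finset.sum_congr rfl fun a ha => ?_
  rw [Finset.sum_div]
  refine Finset.sum_congr rfl fun i _ => ?_
  rw [← Finset.mul_prod_erase s _ ha]
  have h2 := hP _ (Finset.erase_subset a s)
  have h3 := hne a ha
  have h4 : (x - a) ^ k = (x - a) ^ i.1 * (x - a) ^ (k - i.1) := by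
    rw [← pow_add]; congr 1; omega
  have h5 : Polynomial.eval x (r a i) = (r a i).coeff 0 := by
    conv_lhs => rw [hconst a ha i]
    simp
  rw [h5, h4, one_div, inv_pow]
  field_simp

lemma eval_cyclotomic_eq_prod {N : ℕ} (hN : 1 ≤ N) (x : ℂ) :
    (Polynomial.cyclotomic N ℂ).eval x = ∏ r ∈ primitiveRoots N ℂ, (x - r) := by
  rw [Polynomial.cyclotomic_eq_prod_X_sub_primitiveRoots
    (Complex.isPrimitiveRoot_exp N (by omega)), Polynomial.eval_prod]
  simp

lemma notMem_primitiveRoots {N : ℕ} (hN : 1 ≤ N) {x : ℂ} (hx : ‖x‖ < 1) :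
    x ∉ primitiveRoots N ℂ := by
  intro h
  have := ((mem_primitiveRoots (by omega)).1 h).norm'_eq_one (by omega)
  linarith

lemma eval_cyclotomic_ne_zero {N : ℕ} (hN : 1 ≤ N) {x : ℂ} (hx : ‖x‖ < 1) :
    (Polynomial.cyclotomic N ℂ).eval x ≠ 0 := by
  rw [eval_cyclotomic_eq_prod hN, Finset.prod_ne_zero_iff]
  intro r hr h
  exact notMem_primitiveRoots hN hx (by rwa [sub_eq_zero.1 h])

/-- Inversion permutes the primitive roots and `x(x⁻¹ - r) = (-r)(x - r⁻¹)`, so the sign is the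
value `Φ_N(0)`. -/
lemma eval_inv_cyclotomic {N : ℕ} (hN : 1 ≤ N) {x : ℂ} (hx : x ≠ 0) :
    x ^ N.totient * (Polynomial.cyclotomic N ℂ).eval x⁻¹ =
      (if N = 1 then -1 else 1) * (Polynomial.cyclotomic N ℂ).eval x := by
  have h0 : (Polynomial.cyclotomic N ℂ).eval 0 = if N = 1 then -1 else 1 := by
    split_ifs with h
    · simp [h]
    · rw [← Polynomial.coeff_zero_eq_eval_zero, Polynomial.cyclotomic_coeff_zero _ (by omega)]
  have hcard : (primitiveRoots N ℂ).card = N.totient :=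
    (Complex.isPrimitiveRoot_exp N (by omega)).card_primitiveRoots
  rw [← h0, eval_cyclotomic_eq_prod hN, eval_cyclotomic_eq_prod hN, eval_cyclotomic_eq_prod hN,
    ← hcard, ← Finset.prod_const, ← Finset.prod_mul_distrib]
  have h1 : ∏ r ∈ primitiveRoots N ℂ, (x - r) = ∏ r ∈ primitiveRoots N ℂ, (x - r⁻¹) := by
    refine Finset.prod_nbij' (fun r => r⁻¹) (fun r => r⁻¹) ?_ ?_ ?_ ?_ ?_
    · intro r hr
      rw [mem_primitiveRoots (by omega)] at hr ⊢
      exact hr.inv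
    · intro r hr
      rw [mem_primitiveRoots (by omega)] at hr ⊢
      exact hr.inv
    all_goals simp
  rw [h1, ← Finset.prod_mul_distrib]
  refine Finset.prod_congr rfl fun r hr => ?_
  have hr0 : r ≠ 0 := ((mem_primitiveRoots (by omega)).1 hr).ne_zero (by omega)
  field_simp
  ring

/-! ### Reciprocal numerators and the single series -/

/-- The hypotheses on the numerator in the main theorem. -/
structure IsReciprocalNumerator (k N : ℕ) (Q : ℂ[X]) : Prop where
  deg : Q.natDegree < Nat.totient N * k
  eval_zero : Q.eval 0 = 0
  symm : ∀ x : ℂ, x ≠ 0 →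
    Q.eval x = (if N = 1 then (-x) ^ k else x ^ (Nat.totient N * k)) * Q.eval (1 / x)

section

variable {k N : ℕ} {Q : ℂ[X]}

lemma IsReciprocalNumerator.pow (hQ : IsReciprocalNumerator k N Q) {s : ℕ} (hs : 1 ≤ s) :
    IsReciprocalNumerator (s * k) N (Q ^ s) := by
  refine ⟨?_, ?_, fun x hx => ?_⟩
  · rw [Polynomial.natDegree_pow]
    calc s * Q.natDegree < s * (N.totient * k) := Nat.mul_lt_mul_of_pos_left hQ.deg hs
      _ = _ := by ring
  · rw [Polynomial.eval_pow, hQ.eval_zero, zero_pow (by omega)]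
  · rw [Polynomial.eval_pow, hQ.symm x hx, mul_pow, Polynomial.eval_pow]
    congr 1
    split_ifs
    · rw [← pow_mul, mul_comm]
    · rw [← pow_mul]; ring_nf

/-- For `N = 1` the sign `(-1)^k` in the symmetry of `Q` cancels the one from `Φ_1(1/x)`. -/
lemma IsReciprocalNumerator.ratio_inv (hQ : IsReciprocalNumerator k N Q) (hN : 1 ≤ N) {x : ℂ}
    (hx0 : x ≠ 0) : ratio k N Q x⁻¹ = ratio k N Q x := by
  have h1 := eval_inv_cyclotomic hN hx0
  have h2 := hQ.symm x hx0
  rw [one_div] at h2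
  have h3 : x ^ (N.totient * k) * (Polynomial.cyclotomic N ℂ).eval x⁻¹ ^ k =
      (if N = 1 then -1 else 1) ^ k * (Polynomial.cyclotomic N ℂ).eval x ^ k := by
    rw [pow_mul, ← mul_pow, h1, mul_pow]
  have hxp : x ^ (N.totient * k) ≠ 0 := pow_ne_zero _ hx0
  rw [ratio, ratio, h2, ← mul_div_mul_left _ _ hxp, h3]
  split_ifs with h
  · subst h
    have h4 : ((-1 : ℂ) ^ k) * (-1) ^ k = 1 := by rw [← mul_pow]; simp
    rw [Nat.totient_one, one_mul, neg_pow x, div_mul_eq_div_div]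
    congr 1
    rw [div_eq_iff (pow_ne_zero _ (by norm_num))]
    linear_combination (-(x ^ k * Polynomial.eval x⁻¹ Q)) * h4
  · rw [one_pow, one_mul]

lemma continuousAt_ratio (hN : 1 ≤ N) {x : ℂ} (hx : ‖x‖ < 1) : ContinuousAt (ratio k N Q) x :=
  Q.continuousAt.div ((Polynomial.continuousAt _).pow k)
    (pow_ne_zero _ (eval_cyclotomic_ne_zero hN hx))

/-- Averaging the partial fraction expansions at `x` and at `1/x` yields the parity-symmetric
combinations that modularity requires, plus a constant `c₀`; letting `x → 0` shows `c₀ = 0`. -/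
lemma IsReciprocalNumerator.exists_ratio_eq (hQ : IsReciprocalNumerator k N Q) (hN : 1 ≤ N) :
    ∃ c : ℂ → ℕ → ℂ, ∀ x : ℂ, ‖x‖ < 1 → ratio k N Q x =
      ∑ r ∈ primitiveRoots N ℂ, ∑ j ∈ Finset.range k,
        c r j * (polylog j (r⁻¹ * x) + (-1) ^ (j + 1) * polylog j (r * x)) := by
  have hcard : (primitiveRoots N ℂ).card = N.totient :=
    (Complex.isPrimitiveRoot_exp N (by omega)).card_primitiveRoots
  obtain ⟨c, hc⟩ := exists_div_prod_pow_eq (primitiveRoots N ℂ) k Q (by rw [hcard]; exact hQ.deg)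
  choose! e₀ e he using fun i : Fin k => exists_pow_eq_sum_polylogPoly (Nat.sub_le k i)
  set c₀ : ℂ := ∑ r ∈ primitiveRoots N ℂ, ∑ i, c r i * (-r⁻¹) ^ (k - i.1) * e₀ i
  set d : ℂ → ℕ → ℂ := fun r j => ∑ i, c r i * (-r⁻¹) ^ (k - i.1) * e i j with hd
  have h1 : ∀ x ∉ primitiveRoots N ℂ, ratio k N Q x = c₀ + ∑ r ∈ primitiveRoots N ℂ,
      ∑ j ∈ Finset.range k, d r j * (polylog j (r⁻¹ * x) + (polylogPoly j).eval 1) := by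
    intro x hx
    rw [ratio, eval_cyclotomic_eq_prod hN, hc x hx, ← Finset.sum_add_distrib]
    refine Finset.sum_congr rfl fun r hr => ?_
    have hr0 : r ≠ 0 := ((mem_primitiveRoots (by omega)).1 hr).ne_zero (by omega)
    have hxr : x - r ≠ 0 := fun h => hx (by rwa [sub_eq_zero.1 h])
    have h2 : 1 / (x - r) = -r⁻¹ * (1 / (1 - r⁻¹ * x)) := by
      have : 1 - r⁻¹ * x = -r⁻¹ * (x - r) := by field_simp; ring
      rw [this]
      field_simp
    have h3 : ∀ i : Fin k, c r i * (1 / (x - r)) ^ (k - i.1) =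
        c r i * (-r⁻¹) ^ (k - i.1) * e₀ i + ∑ j ∈ Finset.range k,
          c r i * (-r⁻¹) ^ (k - i.1) * e i j * (polylogPoly j).eval (1 / (1 - r⁻¹ * x)) := by
      intro i
      rw [h2, mul_pow, he i (1 / (1 - r⁻¹ * x)), mul_add, mul_add, Finset.mul_sum, Finset.mul_sum]
      congr 1
      · ring
      · exact Finset.sum_congr rfl fun j _ => by ring
    rw [Finset.sum_congr rfl fun i _ => h3 i, Finset.sum_add_distrib, Finset.sum_comm]
    congr 1
    refine Finset.sum_congr rfl fun j _ => ?_
    rw [polylog, sub_add_cancel, hd, Finset.sum_mul]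
  -- The inverse point contributes `Li_{-j}((rx)⁻¹)`, turned into `±Li_{-j}(rx)` by `polylog_inv`;
  -- the `1/2` is the average.
  set G : ℂ → ℂ := fun x => ∑ r ∈ primitiveRoots N ℂ, ∑ j ∈ Finset.range k,
        d r j / 2 * (polylog j (r⁻¹ * x) + (-1) ^ (j + 1) * polylog j (r * x)) with hG
  have h2 : ∀ x : ℂ, ‖x‖ < 1 → x ≠ 0 → ratio k N Q x - G x = c₀ := by
    intro x hx hx0
    have hxi : x⁻¹ ∉ primitiveRoots N ℂ := by
      intro h
      rw [mem_primitiveRoots (by omega)] at h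
      exact notMem_primitiveRoots hN hx ((mem_primitiveRoots (by omega)).2 (by simpa using h.inv))
    have e1 := h1 x (notMem_primitiveRoots hN hx)
    have e2 := h1 x⁻¹ hxi
    rw [hQ.ratio_inv hN hx0] at e2
    have e3 : ∑ r ∈ primitiveRoots N ℂ,
        ∑ j ∈ Finset.range k, d r j * (polylog j (r⁻¹ * x) + (polylogPoly j).eval 1) +
        ∑ r ∈ primitiveRoots N ℂ,
        ∑ j ∈ Finset.range k, d r j * (polylog j (r⁻¹ * x⁻¹) + (polylogPoly j).eval 1) =
        2 * G x := by
      rw [hG, ← Finset.sum_add_distrib, Finset.mul_sum]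
      refine Finset.sum_congr rfl fun r hr => ?_
      rw [← Finset.sum_add_distrib, Finset.mul_sum]
      refine Finset.sum_congr rfl fun j _ => ?_
      have hr1 := (mem_primitiveRoots (by omega)).1 hr
      have hr0 : r ≠ 0 := hr1.ne_zero (by omega)
      have h3 : r * x ≠ 1 := by
        intro h
        have h4 := congrArg norm h
        rw [norm_mul, hr1.norm'_eq_one (by omega), one_mul, norm_one] at h4
        linarith
      rw [← mul_inv, polylog_inv j h3 (mul_ne_zero hr0 hx0)]
      linear_combination d r j * polylogPoly_eval_one_mul j
    linear_combination (e1 + e2 + e3) / 2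
  have hcont : ContinuousAt (fun x => ratio k N Q x - G x) 0 := by
    refine (continuousAt_ratio hN (by simp)).sub ?_
    refine tendsto_finsetSum _ fun r _ => tendsto_finsetSum _ fun j _ => ?_
    have h3 : ∀ y : ℂ, ContinuousAt (fun x => polylog j (y * x)) 0 := by
      intro y
      have h4 : ContinuousAt (polylog j) (y * 0) :=
        (differentiableAt_polylog j (by simp)).continuousAt
      exact ContinuousAt.comp (f := fun x => y * x) h4 (continuous_const_mul y).continuousAt
    exact ((h3 _).add ((h3 _).const_mul _)).const_mul _
  have h3 : c₀ = 0 := by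
    have h4 : (fun x => ratio k N Q x - G x) =ᶠ[𝓝[≠] 0] fun _ => c₀ := by
      have h5 : ∀ᶠ x in 𝓝[≠] (0 : ℂ), ‖x‖ < 1 :=
        (continuous_norm.continuousAt.eventually_lt_const (by simp)).filter_mono nhdsWithin_le_nhds
      filter_upwards [h5, self_mem_nhdsWithin] with x hx hx0
      exact h2 x hx hx0
    have h5 := tendsto_nhds_unique (hcont.tendsto.mono_left nhdsWithin_le_nhds)
      (tendsto_const_nhds.congr' h4.symm)
    rw [← h5]
    simp [ratio, hQ.eval_zero, hG]
  refine ⟨fun r j => d r j / 2, fun x hx => ?_⟩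
  by_cases hx0 : x = 0
  · simp [hx0, ratio, hQ.eval_zero]
  · have := h2 x hx hx0
    rw [h3, sub_eq_zero] at this
    exact this

lemma IsReciprocalNumerator.summable (hQ : IsReciprocalNumerator k N Q) (hN : 1 ≤ N) {q : ℂ}
    (hq : ‖q‖ < 1) : Summable fun n : ℕ+ => ratio k N Q (q ^ (n : ℕ)) := by
  obtain ⟨c, hc⟩ := hQ.exists_ratio_eq hN
  have h1 : (fun n : ℕ => ratio k N Q (q ^ (n + 1))) = fun n => ∑ r ∈ primitiveRoots N ℂ,
      ∑ j ∈ Finset.range k, c r j *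
        (polylog j (r⁻¹ * q ^ (n + 1)) + (-1) ^ (j + 1) * polylog j (r * q ^ (n + 1))) := by
    funext n
    refine hc _ ?_
    rw [norm_pow]
    exact pow_lt_one₀ (norm_nonneg _) hq n.succ_ne_zero
  rw [← Equiv.pnatEquivNat.symm.summable_iff]
  change Summable fun n : ℕ => ratio k N Q (q ^ (n + 1))
  rw [h1]
  exact summable_sum fun r _ => summable_sum fun j _ =>
    ((summable_polylog j _ hq).add ((summable_polylog j _ hq).mul_left _)).mul_left _

lemma IsReciprocalNumerator.exists_U₁_eq (hQ : IsReciprocalNumerator k N Q) (hN : 1 ≤ N) :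
    ∃ c : ℂ → ℕ → ℂ, ∀ q : ℂ, ‖q‖ < 1 → U₁ k N Q q =
      ∑ r ∈ primitiveRoots N ℂ, ∑ j ∈ Finset.range k,
        c r j * (lambert j r⁻¹ q + (-1) ^ (j + 1) * lambert j r q) := by
  obtain ⟨c, hc⟩ := hQ.exists_ratio_eq hN
  refine ⟨c, fun q hq => ?_⟩
  have h1 : (fun n : ℕ => ratio k N Q (q ^ (n + 1))) = fun n => ∑ r ∈ primitiveRoots N ℂ,
      ∑ j ∈ Finset.range k, c r j *
        (polylog j (r⁻¹ * q ^ (n + 1)) + (-1) ^ (j + 1) * polylog j (r * q ^ (n + 1))) := by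
    funext n
    refine hc _ ?_
    rw [norm_pow]
    exact pow_lt_one₀ (norm_nonneg _) hq n.succ_ne_zero
  rw [U₁, ← Equiv.pnatEquivNat.symm.tsum_eq]
  change ∑' n : ℕ, ratio k N Q (q ^ (n + 1)) = _
  rw [h1]
  refine HasSum.tsum_eq (hasSum_sum fun r _ => hasSum_sum fun j _ => ?_)
  exact ((summable_polylog j _ hq).hasSum.add
    ((summable_polylog j _ hq).hasSum.mul_left _)).mul_left _

/-- Writing `r⁻¹ = qexp (i/N)` with `i` prime to `N`, the series is a member of an Eisenstein family
minus its constant term, and constants are quasimodular of weight `0`. -/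
lemma isMixedQuasimodular_lambert (hN : 1 ≤ N) {r : ℂ} (hr : r ∈ primitiveRoots N ℂ) {j : ℕ}
    (hj : j < k) : IsMixedQuasimodular k N
      (fun τ => lambert j r⁻¹ (qOf τ) + (-1) ^ (j + 1) * lambert j r (qOf τ)) := by
  have : NeZero N := ⟨by omega⟩
  rw [mem_primitiveRoots (by omega)] at hr
  obtain ⟨i, hi, hiN, hir⟩ := (Complex.isPrimitiveRoot_iff _ _ (by omega)).1 hr.inv
  have hqr : qexp (((i : ℤ) : ℂ) / N) = r⁻¹ := by rw [← hir, qexp]; push_cast; rfl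
  have hunit : IsUnit (i : ZMod N) := by rwa [ZMod.isUnit_iff_coprime]
  obtain ⟨C, F, hF, hC⟩ : ∃ (C : ℂ) (F : ZMod N → ℍ → ℂ), IsEisensteinFamily j N F ∧
      ∀ τ, F i τ = C + (lambert j r⁻¹ (qOf τ) + (-1) ^ (j + 1) * lambert j r (qOf τ)) := by
    rcases (by omega : N = 1 ∨ 2 ≤ N) with rfl | hN2
    · obtain ⟨C, hC⟩ := exists_isEisensteinFamily_one j
      refine ⟨C, _, hC, fun τ => ?_⟩
      have : r = 1 := by simpa using hr
      simp [this]
      rfl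
    · refine ⟨cotDeriv j ((((i : ZMod N).cast : ℤ) : ℂ) / N), _,
        isEisensteinFamily_zetaDeriv j hN2, fun τ => ?_⟩
      have h1 : qexp ((((i : ZMod N).cast : ℤ) : ℂ) / N) = r⁻¹ := by
        rw [← hqr]
        exact qexp_div_congr (by omega) (by simp)
      rw [zetaDeriv, qexp_neg, h1, inv_inv]
      rfl
  have h1 : (fun τ => lambert j r⁻¹ (qOf τ) + (-1) ^ (j + 1) * lambert j r (qOf τ)) =
      F i - fun _ => C := by
    funext τ
    simp [hC]
  rw [h1]
  exact Submodule.sub_mem _ (hF.isMixedQuasimodular hj hunit) (isMixedQuasimodular_const _ _ _)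

lemma norm_qOf_lt_one (τ : ℍ) : ‖qOf τ‖ < 1 := norm_qexp_coe_lt_one τ

lemma IsReciprocalNumerator.isMixedQuasimodular_U₁ (hQ : IsReciprocalNumerator k N Q)
    (hN : 1 ≤ N) : IsMixedQuasimodular k N (fun τ => U₁ k N Q (qOf τ)) := by
  obtain ⟨c, hc⟩ := hQ.exists_U₁_eq hN
  have h1 : (fun τ => U₁ k N Q (qOf τ)) = ∑ r ∈ primitiveRoots N ℂ, ∑ j ∈ Finset.range k,
      c r j • fun τ => lambert j r⁻¹ (qOf τ) + (-1) ^ (j + 1) * lambert j r (qOf τ) := by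
    funext τ
    rw [hc _ (norm_qOf_lt_one τ)]
    simp only [Finset.sum_apply, Pi.smul_apply, smul_eq_mul]
  rw [h1]
  exact Submodule.sum_mem _ fun r hr => Submodule.sum_mem _ fun j hj =>
    Submodule.smul_mem _ _ (isMixedQuasimodular_lambert hN hr (Finset.mem_range.1 hj))

end

/-! ### Elementary and complete homogeneous sums -/

/-- Strictly increasing tuples for `δ = 0`, weakly increasing ones for `δ = 1`. -/
def IsChainTuple (δ : ℕ) {t : ℕ} (n : Fin t → ℕ) : Prop := ∀ i j, i < j → n i < n j + δ

instance (δ : ℕ) {t : ℕ} (n : Fin t → ℕ) : Decidable (IsChainTuple δ n) := by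
  unfold IsChainTuple; infer_instance

lemma isChainTuple_snoc {δ t : ℕ} (n : Fin t → ℕ) (a : ℕ) :
    IsChainTuple δ (Fin.snoc n a : Fin (t + 1) → ℕ) ↔ IsChainTuple δ n ∧ ∀ i, n i < a + δ := by
  constructor
  · intro h
    refine ⟨fun i j hij => ?_, fun i => ?_⟩
    · simpa using h i.castSucc j.castSucc (by simpa using hij)
    · simpa using h i.castSucc (Fin.last t) (Fin.castSucc_lt_last i)
  · rintro ⟨h1, h2⟩ i j hij
    induction i using Fin.lastCases with
    | last => exact absurd hij (Fin.le_last j).not_gt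
    | cast i =>
      induction j using Fin.lastCases with
      | last => simpa using h2 i
      | cast j => simpa using h1 i j (by simpa using hij)

/-- The chains of length `t` with values below `M`. -/
def chainTuples (δ t M : ℕ) : Finset (Fin t → ℕ) :=
  (Fintype.piFinset fun _ => Finset.range M).filter (IsChainTuple δ)

lemma mem_chainTuples {δ t M : ℕ} {n : Fin t → ℕ} :
    n ∈ chainTuples δ t M ↔ (∀ i, n i < M) ∧ IsChainTuple δ n := by
  simp [chainTuples]

/-- The elementary (`δ = 0`) or complete homogeneous (`δ = 1`) symmetric function of degree `t`
of `x 0, …, x (M - 1)`. -/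
def chainSum (δ : ℕ) (x : ℕ → ℂ) (t M : ℕ) : ℂ := ∑ n ∈ chainTuples δ t M, ∏ j, x (n j)

lemma chainSum_zero_left (δ : ℕ) (x : ℕ → ℂ) (M : ℕ) : chainSum δ x 0 M = 1 := by
  have : chainTuples δ 0 M = Finset.univ := by
    ext n
    simp only [mem_chainTuples, IsChainTuple, Finset.mem_univ, iff_true]
    exact ⟨fun i => i.elim0, fun i => i.elim0⟩
  simp [chainSum, this]

lemma chainSum_zero_right (δ : ℕ) (x : ℕ → ℂ) (t : ℕ) : chainSum δ x (t + 1) 0 = 0 := by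
  refine Finset.sum_eq_zero fun n hn => ?_
  exact absurd ((mem_chainTuples.1 hn).1 0) (Nat.not_lt_zero _)

/-- Either the last entry is below `M`, or it equals `M` and the preceding entries are below `M +
δ`: this covers both the strict and the weak case. -/
lemma chainSum_succ_succ {δ : ℕ} (hδ : δ ≤ 1) (x : ℕ → ℂ) (t M : ℕ) :
    chainSum δ x (t + 1) (M + 1) = chainSum δ x (t + 1) M + x M * chainSum δ x t (M + δ) := by
  rw [chainSum, ← Finset.sum_filter_add_sum_filter_not _ (fun n => n (Fin.last t) < M)]
  congr 1
  · refine Finset.sum_congr ?_ fun _ _ => rfl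
    ext n
    rw [Finset.mem_filter, mem_chainTuples, mem_chainTuples]
    constructor
    · rintro ⟨⟨_, h2⟩, h3⟩
      refine ⟨fun i => ?_, h2⟩
      rcases (Fin.le_last i).lt_or_eq with h | h
      · have := h2 i _ h
        omega
      · rwa [h]
    · rintro ⟨h1, h2⟩
      exact ⟨⟨fun i => (h1 i).trans (Nat.lt_succ_self M), h2⟩, h1 _⟩
  · rw [chainSum, Finset.mul_sum]
    refine Finset.sum_bij' (fun n _ => Fin.init n) (fun n _ => Fin.snoc n M) ?_ ?_ ?_ ?_ ?_
    · intro n hn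
      rw [Finset.mem_filter, mem_chainTuples] at hn
      obtain ⟨⟨h1, h2⟩, h3⟩ := hn
      have h4 : n (Fin.last t) = M := by have := h1 (Fin.last t); omega
      rw [← Fin.snoc_init_self n, isChainTuple_snoc, h4] at h2
      exact mem_chainTuples.2 ⟨h2.2, h2.1⟩
    · intro n hn
      rw [mem_chainTuples] at hn
      rw [Finset.mem_filter, mem_chainTuples]
      refine ⟨⟨fun i => ?_, (isChainTuple_snoc _ _).2 ⟨hn.2, hn.1⟩⟩, by simp⟩
      induction i using Fin.lastCases with
      | last => simp
      | cast i => have := hn.1 i; simp; omega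
    · intro n hn
      rw [Finset.mem_filter, mem_chainTuples] at hn
      have h4 : n (Fin.last t) = M := by have := hn.1.1 (Fin.last t); omega
      conv_rhs => rw [← Fin.snoc_init_self n, h4]
    · intro n _
      simp
    · intro n hn
      rw [Finset.mem_filter, mem_chainTuples] at hn
      have h4 : n (Fin.last t) = M := by have := hn.1.1 (Fin.last t); omega
      rw [Fin.prod_univ_castSucc, h4, mul_comm]
      rfl

/-- The sign `-1` for elementary sums and `1` for complete homogeneous sums. -/
def chainSign (δ : ℕ) : ℂ := if δ = 0 then -1 else 1

-- The generating series is `∏ (1 + x_i X)` for `δ = 0` and `∏ (1 - x_i X)⁻¹` for `δ = 1`; the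
-- identity is its logarithmic derivative, proved one factor at a time.
open PowerSeries in
lemma derivative_mk_chainSum {δ : ℕ} (hδ : δ ≤ 1) (x : ℕ → ℂ) (M : ℕ) :
    d⁄dX ℂ (mk fun t => chainSum δ x t M) =
      (mk fun s => chainSign δ ^ s * ∑ i ∈ Finset.range M, x i ^ (s + 1)) *
        mk fun t => chainSum δ x t M := by
  induction M with
  | zero =>
    have h1 : (mk fun t => chainSum δ x t 0) = 1 := by
      ext t
      rw [coeff_mk, coeff_one]
      rcases t with _ | t
      · simp [chainSum_zero_left]
      · simp [chainSum_zero_right]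
    have h2 : (mk fun s => chainSign δ ^ s * ∑ i ∈ Finset.range 0, x i ^ (s + 1)) = 0 := by
      ext; simp
    rw [h1, h2]
    simp
  | succ M ih =>
    set A : ℕ → ℂ⟦X⟧ := fun M => mk fun t => chainSum δ x t M with hA
    set L : ℕ → ℂ⟦X⟧ := fun M => mk fun s => chainSign δ ^ s * ∑ i ∈ Finset.range M, x i ^ (s + 1)
      with hL
    set g : ℂ⟦X⟧ := mk fun s => chainSign δ ^ s * x M ^ (s + 1) with hg
    change d⁄dX ℂ (A (M + 1)) = L (M + 1) * A (M + 1)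
    change d⁄dX ℂ (A M) = L M * A M at ih
    have hLs : L (M + 1) = L M + g := by
      ext s
      simp only [hL, hg, coeff_mk, map_add, Finset.sum_range_succ, mul_add]
    have hrec : A (M + 1) = A M + C (x M) * X * A (M + δ) := by
      ext t
      rw [map_add, mul_assoc, coeff_C_mul]
      rcases t with _ | t
      · simp [hA, chainSum_zero_left]
      · rw [coeff_succ_X_mul]
        simp only [hA, coeff_mk, chainSum_succ_succ hδ]
    -- `g` is the geometric series `x_M / (1 - ε x_M X)`, with `ε` the sign, known only through this
    -- equation.
    have hgg : g = C (x M) + C (chainSign δ) * C (x M) * X * g := by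
      ext s
      rw [map_add, mul_assoc, mul_assoc, coeff_C_mul, coeff_C_mul]
      rcases s with _ | s
      · simp [hg]
      · rw [coeff_succ_X_mul, coeff_C, if_neg s.succ_ne_zero]
        simp only [hg, coeff_mk]
        ring
    have hD : d⁄dX ℂ (C (x M) * X * A (M + δ)) =
        C (x M) * (A (M + δ) + X * d⁄dX ℂ (A (M + δ))) := by
      rw [mul_assoc, Derivation.leibniz, Derivation.leibniz, derivative_C, derivative_X]
      simp only [smul_eq_mul, mul_zero, mul_one, add_zero]
      ring
    have hD2 := congrArg (d⁄dX ℂ) hrec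
    rw [map_add, hD, ih] at hD2
    rw [hLs]
    interval_cases δ
    · simp only [chainSign, if_true, map_neg, map_one, add_zero] at hgg hD2 hrec
      rw [ih] at hD2
      rw [hD2, hrec]
      linear_combination (-A M) * hgg
    · simp only [chainSign, one_ne_zero, if_false, map_one] at hgg hD2 hrec
      -- For `δ = 1` the recursion is implicit, `(1 - x_M X) A(M+1) = A(M)`, so this factor has to
      -- be cancelled.
      have hne : (1 - C (x M) * X : ℂ⟦X⟧) ≠ 0 := by
        intro h
        have := congrArg (coeff 0) h
        simp at this
      refine mul_left_cancel₀ hne ?_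
      linear_combination hD2 + (-A (M + 1)) * hgg - L M * hrec

lemma chainSum_newton {δ : ℕ} (hδ : δ ≤ 1) (x : ℕ → ℂ) (t M : ℕ) :
    ((t : ℂ) + 1) * chainSum δ x (t + 1) M = ∑ s ∈ Finset.range (t + 1),
      chainSign δ ^ s * (∑ i ∈ Finset.range M, x i ^ (s + 1)) * chainSum δ x (t - s) M := by
  have h := congrArg (PowerSeries.coeff t) (derivative_mk_chainSum hδ x M)
  rw [PowerSeries.coeff_derivative, PowerSeries.coeff_mul,
    Finset.Nat.sum_antidiagonal_eq_sum_range_succ_mk] at h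
  simp only [PowerSeries.coeff_mk] at h
  rw [mul_comm, h]

lemma summable_prod_tuple {x : ℕ → ℂ} (hx : Summable x) (t : ℕ) :
    Summable fun n : Fin t → ℕ => ∏ j, x (n j) := by
  rw [← summable_norm_iff] at hx ⊢
  simp only [norm_prod]
  induction t with
  | zero => exact .of_finite
  | succ t ih =>
    rw [← (Fin.consEquiv fun _ => ℕ).summable_iff]
    have := hx.mul_of_nonneg ih (fun _ => norm_nonneg _)
      (fun _ => Finset.prod_nonneg fun _ _ => norm_nonneg _)
    refine this.congr fun p => ?_
    simp [Fin.consEquiv, Fin.prod_univ_succ]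

/-- The limit of `chainSum δ x t M` as `M → ∞`. -/
def chainTsum (δ : ℕ) (x : ℕ → ℂ) (t : ℕ) : ℂ :=
  ∑' n : {n : Fin t → ℕ // IsChainTuple δ n}, ∏ j, x (n.1 j)

/-- Bounding all entries by `M` exhausts the tuples, so absolute convergence transfers the finite
Newton identities to the infinite sums. -/
lemma tendsto_chainSum (δ : ℕ) {x : ℕ → ℂ} (hx : Summable x) (t : ℕ) :
    Tendsto (chainSum δ x t) atTop (𝓝 (chainTsum δ x t)) := by
  have h1 : Summable fun n : {n : Fin t → ℕ // IsChainTuple δ n} => ∏ j, x (n.1 j) :=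
    (summable_prod_tuple hx t).subtype _
  have h2 : Tendsto (fun M => (chainTuples δ t M).subtype (IsChainTuple δ)) atTop atTop := by
    refine tendsto_atTop_finset_of_monotone ?_ ?_
    · intro M M' h n hn
      rw [Finset.mem_subtype, mem_chainTuples] at hn ⊢
      exact ⟨fun i => (hn.1 i).trans_le h, hn.2⟩
    · intro n
      refine ⟨(Finset.univ.sup n.1) + 1, ?_⟩
      rw [Finset.mem_subtype, mem_chainTuples]
      exact ⟨fun i => Nat.lt_succ_of_le (Finset.le_sup (Finset.mem_univ i)), n.2⟩
  have h3 := h1.hasSum.comp h2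
  refine h3.congr fun M => ?_
  rw [Function.comp, Finset.sum_subtype_eq_sum_filter (f := fun n : Fin t → ℕ => ∏ j, x (n j)),
    chainSum, Finset.filter_true_of_mem fun n hn => (mem_chainTuples.1 hn).2]

lemma chainTsum_newton {δ : ℕ} (hδ : δ ≤ 1) {x : ℕ → ℂ} (hx : Summable x) (t : ℕ) :
    ((t : ℂ) + 1) * chainTsum δ x (t + 1) = ∑ s ∈ Finset.range (t + 1),
      chainSign δ ^ s * (∑' i, x i ^ (s + 1)) * chainTsum δ x (t - s) := by
  have hpow : ∀ s : ℕ, Summable fun i => x i ^ (s + 1) := by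
    intro s
    refine hx.norm.of_norm_bounded_eventually_nat ?_
    have := hx.norm.tendsto_atTop_zero
    filter_upwards [this.eventually_le_const zero_lt_one] with i hi
    rw [norm_pow]
    exact pow_le_of_le_one (norm_nonneg _) hi s.succ_ne_zero
  have h1 := (tendsto_chainSum δ hx (t + 1)).const_mul ((t : ℂ) + 1)
  have h2 : Tendsto (fun M => ∑ s ∈ Finset.range (t + 1),
      chainSign δ ^ s * (∑ i ∈ Finset.range M, x i ^ (s + 1)) * chainSum δ x (t - s) M) atTop
      (𝓝 (∑ s ∈ Finset.range (t + 1),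
        chainSign δ ^ s * (∑' i, x i ^ (s + 1)) * chainTsum δ x (t - s))) :=
    tendsto_finsetSum _ fun s _ => (((hpow s).hasSum.tendsto_sum_nat).const_mul _).mul
      (tendsto_chainSum δ hx _)
  exact tendsto_nhds_unique h1 (h2.congr fun M => (chainSum_newton hδ x t M).symm)

lemma chainTsum_zero (δ : ℕ) {x : ℕ → ℂ} (hx : Summable x) : chainTsum δ x 0 = 1 := by
  exact tendsto_nhds_unique (tendsto_chainSum δ hx 0)
    (tendsto_const_nhds.congr fun M => (chainSum_zero_left δ x M).symm)

/-! ### The exponential formula -/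

/-- The coefficient of `X ^ t` in `exp (∑ s, z s * X ^ (s + 1))`. -/
def expCoeff (z : ℕ → ℂ) (t : ℕ) : ℂ :=
  ∑ p : Nat.Partition t, ∏ s ∈ Finset.range t,
    z s ^ p.parts.count (s + 1) / (p.parts.count (s + 1)).factorial

lemma count_eq_zero_of_lt {t : ℕ} (p : Nat.Partition t) {s : ℕ} (h : t < s) :
    p.parts.count s = 0 := by
  rw [Multiset.count_eq_zero]
  intro hs
  have := Nat.Partition.le_of_mem_parts hs
  omega

lemma expCoeff_eq (z : ℕ → ℂ) {t T : ℕ} (h : t ≤ T) :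
    expCoeff z t = ∑ p : Nat.Partition t, ∏ s ∈ Finset.range T,
      z s ^ p.parts.count (s + 1) / (p.parts.count (s + 1)).factorial := by
  refine Finset.sum_congr rfl fun p _ => Finset.prod_subset (by simpa using h) fun s _ hs => ?_
  rw [Finset.mem_range, not_lt] at hs
  simp [count_eq_zero_of_lt p (Nat.lt_succ_of_le hs)]

lemma sum_count_mul {t : ℕ} (p : Nat.Partition t) :
    ∑ s ∈ Finset.range t, p.parts.count (s + 1) * (s + 1) = t := by
  conv_rhs => rw [← p.parts_sum, Finset.sum_multiset_count]
  have h1 : p.parts.toFinset ⊆ (Finset.range t).map ⟨Nat.succ, Nat.succ_injective⟩ := by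
    intro s hs
    rw [Multiset.mem_toFinset] at hs
    have h2 := Nat.Partition.le_of_mem_parts hs
    have h3 := p.parts_pos hs
    simp only [Finset.mem_map, Finset.mem_range, Function.Embedding.coeFn_mk]
    exact ⟨s - 1, by omega, by simp; omega⟩
  rw [Finset.sum_subset h1, Finset.sum_map]
  · rfl
  · intro s _ hs
    rw [Multiset.mem_toFinset, ← Multiset.count_eq_zero] at hs
    simp [hs]

lemma sum_partition_erase {t s : ℕ} (hs : s < t + 1) (G : Multiset ℕ → ℂ) :
    ∑ p : Nat.Partition (t + 1) with s + 1 ∈ p.parts, G (p.parts.erase (s + 1)) =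
      ∑ p : Nat.Partition (t - s), G p.parts := by
  refine Finset.sum_bij'
    (fun p hp => ⟨p.parts.erase (s + 1), fun h => p.parts_pos (Multiset.mem_of_mem_erase h), ?_⟩)
    (fun p _ => ⟨(s + 1) ::ₘ p.parts, fun h => ?_, ?_⟩) ?_ ?_ ?_ ?_ ?_
  · have h1 := Multiset.sum_erase (Finset.mem_filter.1 hp).2
    rw [p.parts_sum] at h1
    omega
  · rcases Multiset.mem_cons.1 h with rfl | h
    · exact Nat.succ_pos _
    · exact p.parts_pos h
  · rw [Multiset.sum_cons, p.parts_sum]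
    omega
  · simp
  · simp
  · intro p hp
    ext1
    exact Multiset.cons_erase (Finset.mem_filter.1 hp).2
  · intro p hp
    ext1
    simp
  · intro p hp
    rfl

/-- This is `F' = Z'F` for `F = exp Z`. Weight each partition by `t + 1 = ∑ (s+1) m_{s+1}` and erase
one part `s + 1`, using `m z^m/m! = z · z^(m-1)/(m-1)!`. -/
lemma expCoeff_newton (z : ℕ → ℂ) (t : ℕ) :
    ((t : ℂ) + 1) * expCoeff z (t + 1) = ∑ s ∈ Finset.range (t + 1),
      (((s : ℂ) + 1) * z s) * expCoeff z (t - s) := by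
  set w : Multiset ℕ → ℂ := fun m => ∏ s ∈ Finset.range (t + 1),
      z s ^ m.count (s + 1) / (m.count (s + 1)).factorial with hw
  have h1 : ((t : ℂ) + 1) * expCoeff z (t + 1) = ∑ s ∈ Finset.range (t + 1),
      ∑ p : Nat.Partition (t + 1), ((s : ℂ) + 1) * (p.parts.count (s + 1) * w p.parts) := by
    rw [expCoeff, Finset.mul_sum, Finset.sum_comm]
    refine Finset.sum_congr rfl fun p _ => ?_
    have h2 := congrArg (Nat.cast : ℕ → ℂ) (sum_count_mul p)
    push_cast at h2
    rw [← h2, Finset.sum_mul]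
    refine Finset.sum_congr rfl fun s _ => ?_
    ring
  rw [h1]
  refine Finset.sum_congr rfl fun s hs => ?_
  have hs' := Finset.mem_range.1 hs
  rw [← Finset.mul_sum, expCoeff_eq z (show t - s ≤ t + 1 by omega), mul_assoc]
  congr 1
  rw [← sum_partition_erase hs' w, Finset.mul_sum, Finset.sum_filter]
  refine Finset.sum_congr rfl fun p _ => ?_
  split_ifs with h
  · simp only [hw]
    rw [← Finset.mul_prod_erase _ _ hs, ← Finset.mul_prod_erase (Finset.range (t + 1)) _ hs]
    have h3 : ∏ r ∈ (Finset.range (t + 1)).erase s, z r ^ (p.parts.erase (s + 1)).count (r + 1) /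
        (((p.parts.erase (s + 1)).count (r + 1)).factorial : ℂ) =
        ∏ r ∈ (Finset.range (t + 1)).erase s, z r ^ p.parts.count (r + 1) /
        ((p.parts.count (r + 1)).factorial : ℂ) := by
      refine Finset.prod_congr rfl fun r hr => ?_
      rw [Multiset.count_erase_of_ne]
      have := Finset.ne_of_mem_erase hr
      omega
    rw [h3, Multiset.count_erase_self]
    obtain ⟨c, hc⟩ : ∃ c, p.parts.count (s + 1) = c + 1 :=
      ⟨p.parts.count (s + 1) - 1, by have := Multiset.count_pos.2 h; omega⟩
    rw [hc, Nat.add_sub_cancel, Nat.factorial_succ, pow_succ]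
    have h4 : (c.factorial : ℂ) ≠ 0 := by exact_mod_cast c.factorial_ne_zero
    have h5 : (c : ℂ) + 1 ≠ 0 := by exact_mod_cast c.succ_ne_zero
    push_cast
    field_simp
  · simp [Multiset.count_eq_zero.2 h]

/-- The two sides obey the same recursion with the same initial value `1`. -/
lemma chainTsum_eq_expCoeff {δ : ℕ} (hδ : δ ≤ 1) {x : ℕ → ℂ} (hx : Summable x) (t : ℕ) :
    chainTsum δ x t =
      expCoeff (fun s => chainSign δ ^ s / (s + 1) * ∑' i, x i ^ (s + 1)) t := by
  induction t using Nat.strong_induction_on with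
  | _ t ih =>
    rcases t with _ | t
    · rw [chainTsum_zero δ hx, expCoeff]
      simp
    · have h0 : (t : ℂ) + 1 ≠ 0 := by exact_mod_cast t.succ_ne_zero
      refine mul_left_cancel₀ h0 ?_
      rw [chainTsum_newton hδ hx, expCoeff_newton]
      refine Finset.sum_congr rfl fun s _ => ?_
      rw [ih (t - s) (by omega)]
      have h1 : (s : ℂ) + 1 ≠ 0 := by exact_mod_cast s.succ_ne_zero
      congr 1
      field_simp

/-! ### The multiple series as symmetric functions, and their quasimodularity -/

section

variable {t k N : ℕ} {Q : ℂ[X]} {q : ℂ}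

lemma term_eq_prod (q : ℂ) (n : Fin t → ℕ+) :
    term t k N Q q n =
      ∏ j, (fun i : ℕ => ratio k N Q (q ^ (i + 1))) (Equiv.pnatEquivNat (n j)) :=
  Finset.prod_congr rfl fun j _ => by simp [Equiv.pnatEquivNat]

/-- Tuples of positive integers as tuples of natural numbers. -/
def tupleEquiv (δ t : ℕ) (P : (Fin t → ℕ+) → Prop)
    (h : ∀ n, P n ↔ ∀ i j, i < j → (n i).natPred < (n j).natPred + δ) :
    {n : Fin t → ℕ+ // P n} ≃ {n : Fin t → ℕ // IsChainTuple δ n} :=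
  Equiv.subtypeEquiv (Equiv.piCongrRight fun _ => Equiv.pnatEquivNat) h

lemma strictMono_iff_natPred (n : Fin t → ℕ+) :
    StrictMono n ↔ ∀ i j, i < j → (n i).natPred < (n j).natPred + 0 := by
  simp [StrictMono]

lemma monotone_iff_natPred (n : Fin t → ℕ+) :
    Monotone n ↔ ∀ i j, i < j → (n i).natPred < (n j).natPred + 1 := by
  rw [monotone_iff_forall_lt]
  simp only [Nat.lt_succ_iff, PNat.natPred_le_natPred]

lemma U_eq_chainTsum (q : ℂ) :
    U t k N Q q = chainTsum 0 (fun i => ratio k N Q (q ^ (i + 1))) t := by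
  rw [U, chainTsum, ← (tupleEquiv 0 t _ strictMono_iff_natPred).tsum_eq]
  exact tsum_congr fun n => term_eq_prod q n.1

lemma UStar_eq_chainTsum (q : ℂ) :
    UStar t k N Q q = chainTsum 1 (fun i => ratio k N Q (q ^ (i + 1))) t := by
  rw [UStar, chainTsum, ← (tupleEquiv 1 t _ monotone_iff_natPred).tsum_eq]
  exact tsum_congr fun n => term_eq_prod q n.1

/-- The numerator `Q^s` over `Φ_N^(sk)` is the `s`-th power of `ratio`, so these series are the
power sums in Newton's identities. -/
lemma U₁_pow_eq_tsum (s : ℕ) (q : ℂ) :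
    U₁ (s * k) N (Q ^ s) q = ∑' i : ℕ, ratio k N Q (q ^ (i + 1)) ^ s := by
  rw [U₁, ← Equiv.pnatEquivNat.symm.tsum_eq]
  refine tsum_congr fun n => ?_
  simp only [ratio, Polynomial.eval_pow, div_pow, ← pow_mul, mul_comm s k]
  rfl

lemma IsReciprocalNumerator.summable_nat (hQ : IsReciprocalNumerator k N Q) (hN : 1 ≤ N)
    (hq : ‖q‖ < 1) : Summable fun i : ℕ => ratio k N Q (q ^ (i + 1)) :=
  Equiv.pnatEquivNat.symm.summable_iff.2 (hQ.summable hN hq)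

lemma IsReciprocalNumerator.summable_term (hQ : IsReciprocalNumerator k N Q) (hN : 1 ≤ N)
    (hq : ‖q‖ < 1) (t : ℕ) : Summable fun n : Fin t → ℕ+ => term t k N Q q n := by
  have h := (Equiv.piCongrRight fun _ : Fin t => Equiv.pnatEquivNat).summable_iff.2
    (summable_prod_tuple (hQ.summable_nat hN hq) t)
  exact h.congr fun n => (term_eq_prod q n).symm

lemma aeval_expPoly (ε : ℚ) (y : ℕ → ℂ) :
    MvPolynomial.aeval (fun s : Fin t => y s) (expPoly ε t) =
      expCoeff (fun s => (ε : ℂ) ^ s / (s + 1) * y s) t := by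
  rw [expPoly, expCoeff, map_sum]
  refine Finset.sum_congr rfl fun p _ => ?_
  rw [map_prod, Finset.prod_range]
  refine Finset.prod_congr rfl fun s _ => ?_
  simp only [map_mul, map_pow, MvPolynomial.aeval_X, MvPolynomial.aeval_C]
  simp only [eq_ratCast]
  push_cast
  ring

lemma isIsobaric_expPoly (ε : ℚ) (t : ℕ) : IsIsobaric (expPoly ε t) t := by
  refine MvPolynomial.IsWeightedHomogeneous.sum _ _ _ fun p _ => ?_
  have h := MvPolynomial.IsWeightedHomogeneous.prod (w := fun s : Fin t => s.val + 1) Finset.univ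
    (fun s : Fin t => MvPolynomial.C (1 / ((p.parts.count (s.val + 1)).factorial : ℚ)) *
      (MvPolynomial.C (ε ^ s.val / ((s.val : ℚ) + 1)) * MvPolynomial.X s) ^
        (p.parts.count (s.val + 1)))
    (fun s : Fin t => 0 + p.parts.count (s.val + 1) • (0 + (s.val + 1))) fun s _ =>
      (MvPolynomial.isWeightedHomogeneous_C _ _).mul
        (((MvPolynomial.isWeightedHomogeneous_C _ _).mul
          (MvPolynomial.isWeightedHomogeneous_X _ _ _)).pow _)
  convert! h
  simp only [zero_add, smul_eq_mul]
  rw [← Finset.sum_range (fun s => p.parts.count (s + 1) * (s + 1)), sum_count_mul]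

lemma IsReciprocalNumerator.U_eq (hQ : IsReciprocalNumerator k N Q) (hN : 1 ≤ N) (hq : ‖q‖ < 1)
    (t : ℕ) : U t k N Q q = MvPolynomial.aeval
      (fun s : Fin t => U₁ ((s.val + 1) * k) N (Q ^ (s.val + 1)) q) (expPoly (-1) t) := by
  rw [U_eq_chainTsum, chainTsum_eq_expCoeff zero_le_one (hQ.summable_nat hN hq),
    aeval_expPoly (-1) fun s => U₁ ((s + 1) * k) N (Q ^ (s + 1)) q]
  simp [U₁_pow_eq_tsum, chainSign]

lemma IsReciprocalNumerator.UStar_eq (hQ : IsReciprocalNumerator k N Q) (hN : 1 ≤ N)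
    (hq : ‖q‖ < 1) (t : ℕ) : UStar t k N Q q = MvPolynomial.aeval
      (fun s : Fin t => U₁ ((s.val + 1) * k) N (Q ^ (s.val + 1)) q) (expPoly 1 t) := by
  rw [UStar_eq_chainTsum, chainTsum_eq_expCoeff le_rfl (hQ.summable_nat hN hq),
    aeval_expPoly 1 fun s => U₁ ((s + 1) * k) N (Q ^ (s + 1)) q]
  simp [U₁_pow_eq_tsum, chainSign]

/-- The monomial of a partition has weight at most `∑ m_s · sk`, which is `tk` because the parts add
up to `t`. -/
lemma isMixedQuasimodular_aeval_expPoly (ε : ℚ) {y : ℕ → ℍ → ℂ}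
    (hy : ∀ s, IsMixedQuasimodular ((s + 1) * k) N (y s)) :
    IsMixedQuasimodular (t * k) N
      (fun τ => MvPolynomial.aeval (fun s : Fin t => y s τ) (expPoly ε t)) := by
  have h1 : (fun τ => MvPolynomial.aeval (fun s : Fin t => y s τ) (expPoly ε t)) =
      ∑ p : Nat.Partition t, (∏ s ∈ Finset.range t, ((ε : ℂ) ^ s / (s + 1)) ^ p.parts.count (s + 1) /
        ((p.parts.count (s + 1)).factorial : ℂ)) •
        ∏ s ∈ Finset.range t, y s ^ p.parts.count (s + 1) := by
    funext τ
    rw [aeval_expPoly ε fun s => y s τ, expCoeff, Finset.sum_apply]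
    refine Finset.sum_congr rfl fun p _ => ?_
    rw [Pi.smul_apply, Finset.prod_apply, smul_eq_mul, ← Finset.prod_mul_distrib]
    refine Finset.prod_congr rfl fun s _ => ?_
    rw [mul_pow, Pi.pow_apply]
    ring
  rw [h1]
  refine Submodule.sum_mem _ fun p _ => Submodule.smul_mem _ _ ?_
  have h2 := isMixedQuasimodular_prod (Finset.range t) (N := N)
    (k := fun s => p.parts.count (s + 1) * ((s + 1) * k)) fun s _ => (hy s).pow _
  simp only [← mul_assoc] at h2
  rw [← Finset.sum_mul, sum_count_mul] at h2
  exact h2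

lemma IsReciprocalNumerator.isMixedQuasimodular_aeval (hQ : IsReciprocalNumerator k N Q)
    (hN : 1 ≤ N) (ε : ℚ) : IsMixedQuasimodular (t * k) N (fun τ => MvPolynomial.aeval
      (fun s : Fin t => U₁ ((s.val + 1) * k) N (Q ^ (s.val + 1)) (qOf τ)) (expPoly ε t)) :=
  isMixedQuasimodular_aeval_expPoly ε
    (y := fun s τ => U₁ ((s + 1) * k) N (Q ^ (s + 1)) (qOf τ))
    fun s => (hQ.pow (Nat.succ_pos s)).isMixedQuasimodular_U₁ hN

lemma IsReciprocalNumerator.isMixedQuasimodular_U (hQ : IsReciprocalNumerator k N Q)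
    (hN : 1 ≤ N) (t : ℕ) : IsMixedQuasimodular (t * k) N (fun τ => U t k N Q (qOf τ)) := by
  have h := hQ.isMixedQuasimodular_aeval (t := t) hN (-1)
  simp only [← hQ.U_eq hN (norm_qOf_lt_one _)] at h
  exact h

lemma IsReciprocalNumerator.isMixedQuasimodular_UStar (hQ : IsReciprocalNumerator k N Q)
    (hN : 1 ≤ N) (t : ℕ) : IsMixedQuasimodular (t * k) N (fun τ => UStar t k N Q (qOf τ)) := by
  have h := hQ.isMixedQuasimodular_aeval (t := t) hN 1
  simp only [← hQ.UStar_eq hN (norm_qOf_lt_one _)] at h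
  exact h

end

end GenMacMahon

end

theorem theorem1p1 (t k N : ℕ) (ht : 1 ≤ t) (hk : 1 ≤ k) (hN : 1 ≤ N) (Q : ℂ[X])
    (hdeg : Q.natDegree < Nat.totient N * k) (hQ0 : Q.eval 0 = 0)
    (hrec : ∀ x : ℂ, x ≠ 0 →
      Q.eval x = (if N = 1 then (-x) ^ k else x ^ (Nat.totient N * k)) * Q.eval (1 / x)) :
    -- (1)
    ((∀ q : ℂ, ‖q‖ < 1 → Summable fun n : ℕ+ => GenMacMahon.ratio k N Q (q ^ (n : ℕ))) ∧
      GenMacMahon.IsMixedQuasimodular k N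
        (fun τ => GenMacMahon.U₁ k N Q (GenMacMahon.qOf τ))) ∧
    -- (2), convergence of the multiple series
    (∀ q : ℂ, ‖q‖ < 1 →
      (Summable fun n : {n : Fin t → ℕ+ // StrictMono n} => GenMacMahon.term t k N Q q n.1) ∧
      (Summable fun n : {n : Fin t → ℕ+ // Monotone n} => GenMacMahon.term t k N Q q n.1)) ∧
    -- (2), the isobaric polynomials
    (GenMacMahon.IsIsobaric (GenMacMahon.expPoly (-1) t) t ∧
      GenMacMahon.IsIsobaric (GenMacMahon.expPoly 1 t) t ∧
      ∀ q : ℂ, ‖q‖ < 1 →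
        (GenMacMahon.U t k N Q q = MvPolynomial.aeval
          (fun s : Fin t => GenMacMahon.U₁ ((s.val + 1) * k) N (Q ^ (s.val + 1)) q)
          (GenMacMahon.expPoly (-1) t)) ∧
        (GenMacMahon.UStar t k N Q q = MvPolynomial.aeval
          (fun s : Fin t => GenMacMahon.U₁ ((s.val + 1) * k) N (Q ^ (s.val + 1)) q)
          (GenMacMahon.expPoly 1 t))) ∧
    -- (2), quasimodularity
    (GenMacMahon.IsMixedQuasimodular (t * k) N
        (fun τ => GenMacMahon.U t k N Q (GenMacMahon.qOf τ)) ∧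
      GenMacMahon.IsMixedQuasimodular (t * k) N
        (fun τ => GenMacMahon.UStar t k N Q (GenMacMahon.qOf τ))) := by
  have hQ : GenMacMahon.IsReciprocalNumerator k N Q := ⟨hdeg, hQ0, hrec⟩
  refine ⟨⟨fun q hq => hQ.summable hN hq, hQ.isMixedQuasimodular_U₁ hN⟩,
    fun q hq => ⟨(hQ.summable_term hN hq t).subtype _, (hQ.summable_term hN hq t).subtype _⟩,
    ⟨GenMacMahon.isIsobaric_expPoly _ _, GenMacMahon.isIsobaric_expPoly _ _,
      fun q hq => ⟨hQ.U_eq hN hq t, hQ.UStar_eq hN hq t⟩⟩,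
    hQ.isMixedQuasimodular_U hN t, hQ.isMixedQuasimodular_UStar hN t⟩
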